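/- Let $\mu,g,L>0$ and $k_0,k_1\in\mathbb R$ (of arbitrary sign), and let $\Omega=2\pi L\mathbb T\times(0,1)$, where $2\pi L\mathbb T$ is the one-dimensional torus of length $2\pi L$; $H^k(\Omega)$ denotes the usual Sobolev space of functions on $\Omega$. Let $\bar\rho\in C^\infty([0,1])$ satisfy $\inf_{y\in(0,1)}\bar\rho(y)>0$ and $\bar\rho'(y_0)>0$ for some $y_0\in(0,1)$. Then the steady state $(\bar\rho,0,\bar p)$, $\nabla\bar p=-\bar\rho g\,\mathbf e_2$, of the nonhomogeneous incompressible Navier–Stokes equations with gravity $-g\,\mathbf e_2$ is linearly unstable under Navier-slip boundary conditions. Precisely, there exist a constant $\Lambda^*>0$ and real-valued functions $\varrho$, $\mathbf u=(u_1,u_2)$, $q$ of $(t,x,y)$, $t\ge 0$, which are $2\pi L$-periodic in $x$, are $C^\infty$ on $[0,\infty)\times\mathbb R\times[0,1]$ (up to the boundary), and solve the linearized perturbation problem $$\varrho_t+\bar\rho' u_2=0,\qquad \bar\rho\,\mathbf u_t+\nabla q+\varrho g\,\mathbf e_2=\mu\Delta\mathbf u,\qquad \operatorname{div}\mathbf u=0\qquad\text{in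 }\Omega,\ t\ge 0,$$ $$u_2=0\ \text{ at } y=0 \text{ and } y=1,\qquad \partial_y u_1=\frac{k_1}{\mu}u_1\ \text{ at } y=1,\qquad \partial_y u_1=-\frac{k_0}{\mu}u_1\ \text{ at } y=0,$$ such that $\|\varrho(0)\|_{L^2(\Omega)}$, $\|u_1(0)\|_{L^2(\Omega)}$ and $\|u_2(0)\|_{L^2(\Omega)}$ are all positive and, for every integer $k\ge 0$: 1. $\|(\varrho,\mathbf u,q)(t)\|_{H^k(\Omega)}<\infty$ for all $t\ge 0$; 2. $\|f(t)\|_{H^k(\Omega)}=e^{\Lambda^* t}\|f(0)\|_{H^k(\Omega)}$ for all $t\ge 0$ and each $f\in\{\varrho,u_1,u_2,q\}$; 3. $\|(\varrho,\mathbf u,q)(t)\|_{H^k(\Omega)}\to\infty$ as $t\to\infty$. -/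

import Mathlib

open Set Filter Topology MeasureTheory
open scoped ENNReal ContDiff

/- Scalar fields on the slab are functions `f x y` of the horizontal variable `x : ℝ` and the
vertical variable `y ∈ [0,1]`; a function on the horizontal torus of length `2πL` is a
`2πL`-periodic function of `x`. Time-dependent fields are written `f t x y`, `t ≥ 0`. -/

namespace NavierSlip

/-- Time derivative on `[0,∞)` (one-sided at `t = 0`). -/
noncomputable def dT (f : ℝ → ℝ → ℝ → ℝ) (t x y : ℝ) : ℝ :=
  derivWithin (fun s => f s x y) (Ici 0) t

/-- Horizontal derivative. -/
noncomputable def dX (f : ℝ → ℝ → ℝ) (x y : ℝ) : ℝ :=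
  deriv (fun s => f s y) x

/-- Vertical derivative on `[0,1]` (the ordinary derivative for `0 < y < 1`, one-sided at the
boundary points `y = 0` and `y = 1`). -/
noncomputable def dY (f : ℝ → ℝ → ℝ) (x y : ℝ) : ℝ :=
  derivWithin (fun s => f x s) (Icc 0 1) y

/-- The Laplacian in the slab. -/
noncomputable def lap (f : ℝ → ℝ → ℝ) (x y : ℝ) : ℝ :=
  dX (dX f) x y + dY (dY f) x y

/-- `f` is `C^∞` in `(t,x,y)` on `[0,∞) × ℝ × [0,1]`, up to the boundary, and horizontally
periodic with period `2πL`. -/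
def IsSmoothPeriodic (L : ℝ) (f : ℝ → ℝ → ℝ → ℝ) : Prop :=
  ContDiffOn ℝ ∞ (fun p : ℝ × ℝ × ℝ => f p.1 p.2.1 p.2.2) (Ici 0 ×ˢ (univ ×ˢ Icc 0 1)) ∧
  ∀ t ∈ Ici (0 : ℝ), ∀ x : ℝ, ∀ y ∈ Icc (0 : ℝ) 1,
    f t (x + 2 * Real.pi * L) y = f t x y

/-- The `H^k(Ω)` norm, over one period `(0,2πL) × (0,1)`, of a tuple of fields that are smooth up
to the boundary: the square root of the sum of the squared `L²` norms of all partial derivatives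
of order at most `k` of all components. It takes values in `[0,∞]`. -/
noncomputable def sobolevNorm (L : ℝ) (k : ℕ) {n : ℕ} (f : Fin n → ℝ → ℝ → ℝ) : ℝ≥0∞ :=
  (∑ a : Fin n, ∑ i ∈ Finset.range (k + 1), ∑ j ∈ Finset.range (k + 1 - i),
    ∫⁻ p in Ioo (0 : ℝ) (2 * Real.pi * L) ×ˢ Ioo (0 : ℝ) 1,
      ‖(dX^[i] (dY^[j] (f a))) p.1 p.2‖ₑ ^ 2) ^ (1 / 2 : ℝ)

/-- `(ϱ, u = (u₁, u₂), q)` is a smooth, real-valued, horizontally periodic solution, for `t ≥ 0`,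
of the Navier-Stokes equations linearized around the steady state with density `ρbar` and zero
velocity, with Navier-slip conditions on the lower (`y = 0`) and upper (`y = 1`) boundary. -/
structure IsLinearizedSolution (μ g k₀ k₁ L : ℝ) (ρbar : ℝ → ℝ)
    (ϱ u₁ u₂ q : ℝ → ℝ → ℝ → ℝ) : Prop where
  smooth_density : IsSmoothPeriodic L ϱ
  smooth_velocity₁ : IsSmoothPeriodic L u₁
  smooth_velocity₂ : IsSmoothPeriodic L u₂
  smooth_pressure : IsSmoothPeriodic L q
  transport : ∀ t ∈ Ici (0 : ℝ), ∀ x : ℝ, ∀ y ∈ Ioo (0 : ℝ) 1,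
    dT ϱ t x y + deriv ρbar y * u₂ t x y = 0
  momentum₁ : ∀ t ∈ Ici (0 : ℝ), ∀ x : ℝ, ∀ y ∈ Ioo (0 : ℝ) 1,
    ρbar y * dT u₁ t x y + dX (q t) x y = μ * lap (u₁ t) x y
  momentum₂ : ∀ t ∈ Ici (0 : ℝ), ∀ x : ℝ, ∀ y ∈ Ioo (0 : ℝ) 1,
    ρbar y * dT u₂ t x y + dY (q t) x y + ϱ t x y * g = μ * lap (u₂ t) x y
  incompressible : ∀ t ∈ Ici (0 : ℝ), ∀ x : ℝ, ∀ y ∈ Ioo (0 : ℝ) 1,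
    dX (u₁ t) x y + dY (u₂ t) x y = 0
  no_penetration_lower : ∀ t ∈ Ici (0 : ℝ), ∀ x : ℝ, u₂ t x 0 = 0
  no_penetration_upper : ∀ t ∈ Ici (0 : ℝ), ∀ x : ℝ, u₂ t x 1 = 0
  slip_lower : ∀ t ∈ Ici (0 : ℝ), ∀ x : ℝ, dY (u₁ t) x 0 = -(k₀ / μ) * u₁ t x 0
  slip_upper : ∀ t ∈ Ici (0 : ℝ), ∀ x : ℝ, dY (u₁ t) x 1 = (k₁ / μ) * u₁ t x 1

end NavierSlip

namespace NavierSlip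

/-! Look for a normal mode `exp (s t)` times `cos (ξ x)` or `sin (ξ x)` times a profile in `y`, with
`ξ = 1/L`. Eliminating density, pressure and `u₁` leaves a fourth-order problem for the profile `ψ`
of `u₂`: `sμ ψ'''' - (p ψ')' + r ψ = 0`, with `p = 2sμξ² + s²ρ` and `r = sμξ⁴ + s²ξ²ρ - gξ²ρ'`,
where `ψ` vanishes at both ends and the slip conditions are the natural boundary conditions. It is
the Euler–Lagrange equation of a quadratic form `Q_s = s X + s² Y - Z`, in which the rate `s` enters
nonlinearly.

No fixed point in `s` is needed. For small `s > 0` the form is negative somewhere, because `ρ' > 0`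
somewhere (`exists_integ_weight_pos`). For large `s` it is nonnegative, because the boundary terms,
of arbitrary sign, are absorbed by trace inequalities (`trace_one`, `trace_zero`). At the supremum
`s` of the rates where negativity occurs, `Q_s ≥ 0`, yet `Q_s` tends to `0` along normalized
functions (`exists_critical`).

The unknown is `w = ψ''`, a continuous function under the `L²(0,1)` seminorm. Then `Q_s(w,v) = ∫ (sμ
w + K w) v` with `K = lowerOp` smoothing. Nonnegativity forces the residual `sμ w + K w` to `0`
along the sequence (`exists_residual_bound`). Arzelà–Ascoli for `K` then yields a nonzero continuous
`v` with `sμ v + K v = 0` on `[0,1]` (`exists_null_of_seq`), so neither completion nor weak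
derivatives are needed.

This equation is a first-order linear system (`IsModeSystem`), which gives smoothness by
bootstrapping. By uniqueness, `ψ` cannot vanish on all of `{ρ' > 0}`, so the density perturbation is
nonzero. Exact exponential growth follows from homogeneity of the norms. -/

/-! ### Primitives and integrals of continuous functions. -/

/-- The primitive vanishing at `0`, as a linear map on continuous functions. -/
noncomputable def prim : C(ℝ, ℝ) →ₗ[ℝ] C(ℝ, ℝ) where
  toFun f := ⟨fun y => ∫ s in (0 : ℝ)..y, f s,
    intervalIntegral.continuous_primitive (fun a b => f.continuous.intervalIntegrable a b) 0⟩
  map_add' f g := by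
    ext y
    exact intervalIntegral.integral_add (f.continuous.intervalIntegrable _ _)
      (g.continuous.intervalIntegrable _ _)
  map_smul' a f := by
    ext y
    exact intervalIntegral.integral_const_mul a _

theorem prim_apply (f : C(ℝ, ℝ)) (y : ℝ) : prim f y = ∫ s in (0 : ℝ)..y, f s := rfl

@[simp] theorem prim_zero (f : C(ℝ, ℝ)) : prim f 0 = 0 := by simp [prim_apply]

theorem hasDerivAt_prim (f : C(ℝ, ℝ)) (y : ℝ) : HasDerivAt (prim f) (f y) y :=
  intervalIntegral.integral_hasDerivAt_right (f.continuous.intervalIntegrable _ _)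
    (f.continuous.stronglyMeasurableAtFilter _ _) f.continuous.continuousAt

/-- Integration over `[0,1]`. -/
noncomputable def integ : C(ℝ, ℝ) →ₗ[ℝ] ℝ where
  toFun f := prim f 1
  map_add' f g := by simp
  map_smul' a f := by simp

theorem integ_eq_prim (f : C(ℝ, ℝ)) : integ f = prim f 1 := rfl

theorem integ_mono {f g : C(ℝ, ℝ)} (h : ∀ y ∈ Ioo (0 : ℝ) 1, f y ≤ g y) : integ f ≤ integ g :=
  intervalIntegral.integral_mono_on_of_le_Ioo zero_le_one (f.continuous.intervalIntegrable _ _)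
    (g.continuous.intervalIntegrable _ _) h

theorem integ_nonneg {f : C(ℝ, ℝ)} (h : ∀ y ∈ Ioo (0 : ℝ) 1, 0 ≤ f y) : 0 ≤ integ f := by
  simpa using integ_mono (f := 0) (g := f) (by simpa using h)

theorem integ_const (a : ℝ) : integ (ContinuousMap.const ℝ a) = a := by
  simp [integ_eq_prim, prim_apply]

theorem integ_congr {f g : C(ℝ, ℝ)} (h : ∀ y ∈ Ioo (0 : ℝ) 1, f y = g y) : integ f = integ g :=
  le_antisymm (integ_mono fun y hy => (h y hy).le) (integ_mono fun y hy => (h y hy).ge)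

theorem integ_eq_sub {F f : C(ℝ, ℝ)} (hF : ∀ y, HasDerivAt F (f y) y) :
    integ f = F 1 - F 0 :=
  intervalIntegral.integral_eq_sub_of_hasDerivAt (fun y _ => hF y)
    (f.continuous.intervalIntegrable _ _)

theorem integ_mul_deriv {F f G g : C(ℝ, ℝ)} (hF : ∀ y, HasDerivAt F (f y) y)
    (hG : ∀ y, HasDerivAt G (g y) y) :
    integ (F * g) = F 1 * G 1 - F 0 * G 0 - integ (f * G) :=
  intervalIntegral.integral_mul_deriv_eq_deriv_mul (fun y _ => hF y) (fun y _ => hG y)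
    (f.continuous.intervalIntegrable _ _) (g.continuous.intervalIntegrable _ _)

theorem integ_sq_nonneg (f : C(ℝ, ℝ)) : 0 ≤ integ (f * f) :=
  integ_nonneg fun y _ => mul_self_nonneg (f y)

theorem integ_mul_le (f g : C(ℝ, ℝ)) {s : ℝ} (hs : 0 < s) :
    integ (f * g) ≤ s / 2 * integ (f * f) + (2 * s)⁻¹ * integ (g * g) := by
  have : integ (f * g) ≤ integ ((s / 2) • (f * f) + (2 * s)⁻¹ • (g * g)) := by
    refine integ_mono fun y _ => ?_
    simp only [ContinuousMap.mul_apply, ContinuousMap.add_apply, ContinuousMap.smul_apply,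
      smul_eq_mul]
    have h : s / 2 * (f y * f y) + (2 * s)⁻¹ * (g y * g y) - f y * g y
        = (s * f y - g y) ^ 2 / (2 * s) := by field_simp; ring
    have : 0 ≤ (s * f y - g y) ^ 2 / (2 * s) := by positivity
    linarith
  simpa using this

theorem abs_prim_le_of_forall {f : C(ℝ, ℝ)} {M : ℝ} (h : ∀ y ∈ Icc (0 : ℝ) 1, |f y| ≤ M)
    {y : ℝ} (hy : y ∈ Icc (0 : ℝ) 1) : |prim f y| ≤ M := by
  have h0 : 0 ≤ M := (abs_nonneg _).trans (h 0 (by simp))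
  have := intervalIntegral.norm_integral_le_of_norm_le_const (a := 0) (b := y) (f := f) (C := M)
    (fun x hx => h x (by rw [uIoc_of_le hy.1] at hx; exact ⟨hx.1.le, hx.2.trans hy.2⟩))
  rw [sub_zero, abs_of_nonneg hy.1] at this
  exact this.trans (mul_le_of_le_one_right h0 hy.2)

/-! ### The `L²(0,1)` seminorm and pointwise bounds. -/

/-- The `L²(0,1)` seminorm. -/
noncomputable def l2norm (f : C(ℝ, ℝ)) : ℝ := √(integ (f * f))

theorem l2norm_nonneg (f : C(ℝ, ℝ)) : 0 ≤ l2norm f := Real.sqrt_nonneg _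

theorem l2norm_sq (f : C(ℝ, ℝ)) : l2norm f ^ 2 = integ (f * f) :=
  Real.sq_sqrt (integ_sq_nonneg f)

theorem abs_prim_le_l2norm (f : C(ℝ, ℝ)) {y : ℝ} (hy : y ∈ Icc (0 : ℝ) 1) :
    |prim f y| ≤ l2norm f := by
  have h1 : ∀ s > 0, |prim f y| ≤ s / 2 + (2 * s)⁻¹ * l2norm f ^ 2 := by
    intro s hs
    have e1 : |prim f y| ≤ ∫ x in (0 : ℝ)..1, |f x| :=
      (intervalIntegral.abs_integral_le_integral_abs hy.1).trans
        (intervalIntegral.integral_mono_interval le_rfl hy.1 hy.2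
          (Eventually.of_forall fun _ => abs_nonneg _)
          (f.continuous.abs.intervalIntegrable _ _))
    have e2 := integ_mul_le 1 |f| hs
    have e3 : integ (|f| * |f|) = l2norm f ^ 2 := by
      rw [l2norm_sq]; congr 1; ext; simp
    have e4 : integ ((1 : C(ℝ, ℝ)) * 1) = 1 := by
      rw [one_mul]; exact integ_const 1
    rw [one_mul, e3, e4] at e2
    have e5 : integ |f| = ∫ x in (0 : ℝ)..1, |f x| := rfl
    linarith
  refine le_of_forall_pos_le_add fun ε hε => ?_
  have hN := l2norm_nonneg f
  -- The optimal Young parameter is the norm itself; adding `ε` keeps it positive when the norm is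
  -- zero.
  have h2 := h1 (l2norm f + ε) (by linarith)
  refine h2.trans ?_
  have : (2 * (l2norm f + ε))⁻¹ * l2norm f ^ 2 ≤ (l2norm f + ε) / 2 := by
    rw [inv_mul_le_iff₀ (by linarith)]
    nlinarith
  linarith

theorem l2norm_le_of_forall {f : C(ℝ, ℝ)} {M : ℝ} (hM : 0 ≤ M)
    (h : ∀ y ∈ Ioo (0 : ℝ) 1, |f y| ≤ M) : l2norm f ≤ M := by
  refine Real.sqrt_le_iff.2 ⟨hM, ?_⟩
  calc integ (f * f) ≤ integ (ContinuousMap.const ℝ (M ^ 2)) := by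
        refine integ_mono fun y hy => ?_
        have := h y hy
        simp only [ContinuousMap.mul_apply, ContinuousMap.const_apply]
        rw [← abs_mul_abs_self, ← sq]
        gcongr
    _ = M ^ 2 := integ_const _

theorem exists_bound_Icc (f : C(ℝ, ℝ)) : ∃ M : ℝ, 0 ≤ M ∧ ∀ y ∈ Icc (0 : ℝ) 1, |f y| ≤ M := by
  obtain ⟨M, hM⟩ := isCompact_Icc.exists_bound_of_continuousOn
    (s := Icc (0 : ℝ) 1) f.continuous.continuousOn
  exact ⟨M, (norm_nonneg _).trans (hM 0 (by simp)), hM⟩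

/-! ### Recovering `ψ` from `w = ψ''` under Dirichlet conditions. -/

/-- The derivative of the solution of `ψ'' = w`, `ψ 0 = ψ 1 = 0`. -/
noncomputable def psi1 : C(ℝ, ℝ) →ₗ[ℝ] C(ℝ, ℝ) where
  toFun w := prim w - ContinuousMap.const ℝ (integ (prim w))
  map_add' f g := by ext; simp; ring
  map_smul' a f := by ext; simp; ring

/-- The solution of `ψ'' = w`, `ψ 0 = ψ 1 = 0`. -/
noncomputable def psi : C(ℝ, ℝ) →ₗ[ℝ] C(ℝ, ℝ) := prim ∘ₗ psi1

theorem hasDerivAt_psi1 (w : C(ℝ, ℝ)) (y : ℝ) : HasDerivAt (psi1 w) (w y) y :=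
  (hasDerivAt_prim w y).sub_const _

theorem hasDerivAt_psi (w : C(ℝ, ℝ)) (y : ℝ) : HasDerivAt (psi w) (psi1 w y) y :=
  hasDerivAt_prim (psi1 w) y

@[simp] theorem psi_zero (w : C(ℝ, ℝ)) : psi w 0 = 0 := prim_zero _

theorem integ_psi1 (w : C(ℝ, ℝ)) : integ (psi1 w) = 0 := by
  show integ (prim w - ContinuousMap.const ℝ (integ (prim w))) = 0
  rw [map_sub, integ_const, sub_self]

@[simp] theorem psi_one (w : C(ℝ, ℝ)) : psi w 1 = 0 := integ_psi1 w

theorem abs_psi1_le (w : C(ℝ, ℝ)) {y : ℝ} (hy : y ∈ Icc (0 : ℝ) 1) :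
    |psi1 w y| ≤ 2 * l2norm w := by
  have h1 := abs_prim_le_l2norm w hy
  have h2 : |integ (prim w)| ≤ l2norm w :=
    abs_prim_le_of_forall (fun y hy => abs_prim_le_l2norm w hy) (by simp)
  calc |psi1 w y| = |prim w y - integ (prim w)| := rfl
    _ ≤ |prim w y| + |integ (prim w)| := abs_sub _ _
    _ ≤ _ := by linarith

theorem abs_psi_le (w : C(ℝ, ℝ)) {y : ℝ} (hy : y ∈ Icc (0 : ℝ) 1) :
    |psi w y| ≤ 2 * l2norm w :=
  abs_prim_le_of_forall (fun _ hy => abs_psi1_le w hy) hy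

/-! ### The quadratic form and the operator representing it. -/

/-- The bilinear form `∫ c ψ''φ'' + p ψ'φ' + r ψφ - a₁ ψ'(1)φ'(1) - a₀ ψ'(0)φ'(0)`, as a function
of `w = ψ''` and `v = φ''`. -/
noncomputable def form (c : ℝ) (p r : C(ℝ, ℝ)) (a₀ a₁ : ℝ) (w v : C(ℝ, ℝ)) : ℝ :=
  c * integ (w * v) + integ (p * psi1 w * psi1 v) + integ (r * psi w * psi v)
    - a₁ * (psi1 w 1 * psi1 v 1) - a₀ * (psi1 w 0 * psi1 v 0)

/-- The slope constant in `lowerOp`. -/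
noncomputable def lowerSlope (p r : C(ℝ, ℝ)) (a₀ a₁ : ℝ) (w : C(ℝ, ℝ)) : ℝ :=
  -a₁ * psi1 w 1 - a₀ * psi1 w 0 + integ (p * psi1 w) - integ (prim (r * psi w))

/-- The derivative of `lowerOp`. -/
noncomputable def lowerOpDeriv (p r : C(ℝ, ℝ)) (a₀ a₁ : ℝ) (w : C(ℝ, ℝ)) : C(ℝ, ℝ) :=
  ContinuousMap.const ℝ (lowerSlope p r a₀ a₁ w) - p * psi1 w + prim (r * psi w)

/-- The operator representing the lower order part of `form`. -/
noncomputable def lowerOp (p r : C(ℝ, ℝ)) (a₀ a₁ : ℝ) (w : C(ℝ, ℝ)) : C(ℝ, ℝ) :=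
  ContinuousMap.const ℝ (a₀ * psi1 w 0) + prim (lowerOpDeriv p r a₀ a₁ w)

theorem hasDerivAt_lowerOp (p r : C(ℝ, ℝ)) (a₀ a₁ : ℝ) (w : C(ℝ, ℝ)) (y : ℝ) :
    HasDerivAt (lowerOp p r a₀ a₁ w) (lowerOpDeriv p r a₀ a₁ w y) y :=
  (hasDerivAt_prim _ y).const_add _

theorem lowerOp_zero (p r : C(ℝ, ℝ)) (a₀ a₁ : ℝ) (w : C(ℝ, ℝ)) :
    lowerOp p r a₀ a₁ w 0 = a₀ * psi1 w 0 := by simp [lowerOp]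

theorem lowerOp_one (p r : C(ℝ, ℝ)) (a₀ a₁ : ℝ) (w : C(ℝ, ℝ)) :
    lowerOp p r a₀ a₁ w 1 = -a₁ * psi1 w 1 := by
  show a₀ * psi1 w 0 + integ (lowerOpDeriv p r a₀ a₁ w) = _
  rw [lowerOpDeriv, map_add, map_sub, integ_const, lowerSlope]
  ring

theorem lowerOp_sub (p r : C(ℝ, ℝ)) (a₀ a₁ : ℝ) (w v : C(ℝ, ℝ)) :
    lowerOp p r a₀ a₁ (w - v) = lowerOp p r a₀ a₁ w - lowerOp p r a₀ a₁ v := by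
  have h : lowerOpDeriv p r a₀ a₁ (w - v)
      = lowerOpDeriv p r a₀ a₁ w - lowerOpDeriv p r a₀ a₁ v := by
    ext y
    simp only [lowerOpDeriv, lowerSlope, map_sub, mul_sub, ContinuousMap.add_apply,
      ContinuousMap.sub_apply, ContinuousMap.const_apply, ContinuousMap.mul_apply]
    ring
  ext y
  simp only [lowerOp, h, map_sub, ContinuousMap.add_apply,
      ContinuousMap.sub_apply, ContinuousMap.const_apply]
  ring

/-- Two integrations by parts move both derivatives off `φ'' = v`. The slope constant drops out
because `φ'` has mean zero, so it is free to fix the value of `lowerOp` at `1`; the values at `0`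
and `1` produce the boundary terms of the form. -/
theorem integ_lowerOp_mul (p r : C(ℝ, ℝ)) (a₀ a₁ : ℝ) (w v : C(ℝ, ℝ)) :
    integ (lowerOp p r a₀ a₁ w * v) = form 0 p r a₀ a₁ w v := by
  rw [integ_mul_deriv (hasDerivAt_lowerOp p r a₀ a₁ w) (hasDerivAt_psi1 v), lowerOp_zero,
    lowerOp_one]
  have h1 : lowerOpDeriv p r a₀ a₁ w * psi1 v
      = lowerSlope p r a₀ a₁ w • psi1 v - p * psi1 w * psi1 v + prim (r * psi w) * psi1 v := by
    ext y
    simp [lowerOpDeriv]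
    ring
  have h2 := integ_mul_deriv (hasDerivAt_prim (r * psi w)) (hasDerivAt_psi v)
  rw [psi_one, prim_zero] at h2
  rw [h1, map_add, map_sub, map_smul, integ_psi1, h2, form]
  simp
  ring

theorem form_eq_integ (c : ℝ) (p r : C(ℝ, ℝ)) (a₀ a₁ : ℝ) (w v : C(ℝ, ℝ)) :
    form c p r a₀ a₁ w v = integ ((c • w + lowerOp p r a₀ a₁ w) * v) := by
  rw [add_mul, map_add, integ_lowerOp_mul, smul_mul_assoc, map_smul]
  simp [form]
  ring

/-- The source of compactness: `lowerOp` sends `L²`-bounded sets to sets bounded uniformly together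
with their first derivatives. -/
theorem exists_lowerOp_bound (p r : C(ℝ, ℝ)) (a₀ a₁ : ℝ) :
    ∃ C : ℝ, 0 ≤ C ∧ ∀ w : C(ℝ, ℝ), ∀ y ∈ Icc (0 : ℝ) 1,
      |lowerOpDeriv p r a₀ a₁ w y| ≤ C * l2norm w ∧ |lowerOp p r a₀ a₁ w y| ≤ C * l2norm w := by
  obtain ⟨P, hP0, hP⟩ := exists_bound_Icc p
  obtain ⟨R, hR0, hR⟩ := exists_bound_Icc r
  set D : ℝ := 2 * |a₁| + 2 * |a₀| + 2 * P + 2 * R + 2 * P + 2 * R with hD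
  have hD0 : 0 ≤ D := by positivity
  have key : ∀ w : C(ℝ, ℝ), ∀ y ∈ Icc (0 : ℝ) 1, |lowerOpDeriv p r a₀ a₁ w y| ≤ D * l2norm w := by
    intro w y hy
    have hN := l2norm_nonneg w
    have b1 : ∀ y ∈ Icc (0 : ℝ) 1, |(p * psi1 w) y| ≤ 2 * P * l2norm w := fun y hy => by
      rw [ContinuousMap.mul_apply, abs_mul]
      calc |p y| * |psi1 w y| ≤ P * (2 * l2norm w) := by
            gcongr
            · exact hP y hy
            · exact abs_psi1_le w hy
        _ = _ := by ring
    have b2 : ∀ y ∈ Icc (0 : ℝ) 1, |(r * psi w) y| ≤ 2 * R * l2norm w := fun y hy => by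
      rw [ContinuousMap.mul_apply, abs_mul]
      calc |r y| * |psi w y| ≤ R * (2 * l2norm w) := by
            gcongr
            · exact hR y hy
            · exact abs_psi_le w hy
        _ = _ := by ring
    have b3 : ∀ y ∈ Icc (0 : ℝ) 1, |prim (r * psi w) y| ≤ 2 * R * l2norm w :=
      fun y hy => abs_prim_le_of_forall b2 hy
    have b4 : |integ (p * psi1 w)| ≤ 2 * P * l2norm w := abs_prim_le_of_forall b1 (by simp)
    have b5 : |integ (prim (r * psi w))| ≤ 2 * R * l2norm w := abs_prim_le_of_forall b3 (by simp)
    have b6 : |a₁ * psi1 w 1| ≤ 2 * |a₁| * l2norm w := by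
      rw [abs_mul]
      have := mul_le_mul_of_nonneg_left (abs_psi1_le w (y := 1) (by simp)) (abs_nonneg a₁)
      linarith
    have b7 : |a₀ * psi1 w 0| ≤ 2 * |a₀| * l2norm w := by
      rw [abs_mul]
      have := mul_le_mul_of_nonneg_left (abs_psi1_le w (y := 0) (by simp)) (abs_nonneg a₀)
      linarith
    have e : lowerOpDeriv p r a₀ a₁ w y = -(a₁ * psi1 w 1) - a₀ * psi1 w 0 + integ (p * psi1 w)
        - integ (prim (r * psi w)) - (p * psi1 w) y + prim (r * psi w) y := by
      simp [lowerOpDeriv, lowerSlope]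
    have c1 := b1 y hy
    have c3 := b3 y hy
    rw [e]
    rw [abs_le] at *
    constructor <;> nlinarith
  refine ⟨2 * |a₀| + D, by positivity, fun w y hy => ⟨?_, ?_⟩⟩
  · have := key w y hy
    have : 0 ≤ |a₀| * l2norm w := mul_nonneg (abs_nonneg _) (l2norm_nonneg w)
    nlinarith
  · have h1 := abs_prim_le_of_forall (key w) hy
    have h2 : |a₀ * psi1 w 0| ≤ 2 * |a₀| * l2norm w := by
      rw [abs_mul]
      have := mul_le_mul_of_nonneg_left (abs_psi1_le w (y := 0) (by simp)) (abs_nonneg a₀)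
      linarith
    have h3 : lowerOp p r a₀ a₁ w y = a₀ * psi1 w 0 + prim (lowerOpDeriv p r a₀ a₁ w) y := rfl
    rw [h3]
    refine (abs_add_le _ _).trans ?_
    linarith

theorem abs_integ_mul_le (f g : C(ℝ, ℝ)) : |integ (f * g)| ≤ l2norm f * l2norm g := by
  have key : ∀ f g : C(ℝ, ℝ), integ (f * g) ≤ l2norm f * l2norm g := by
    intro f g
    have hf := l2norm_nonneg f
    have hg := l2norm_nonneg g
    have h1 : ∀ ε > 0, integ (f * g) ≤ (l2norm f + ε) * (l2norm g + ε) := by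
      intro ε hε
      -- This ratio balances the two Young terms; shifting both norms by `ε` avoids division by
      -- zero, and `ε → 0` gives Cauchy–Schwarz.
      have h := integ_mul_le f g (s := (l2norm g + ε) / (l2norm f + ε)) (by positivity)
      rw [← l2norm_sq, ← l2norm_sq] at h
      have e1 : (l2norm g + ε) / (l2norm f + ε) / 2 * l2norm f ^ 2
          ≤ (l2norm g + ε) / (l2norm f + ε) / 2 * (l2norm f + ε) ^ 2 := by
        gcongr; linarith
      have e2 : (2 * ((l2norm g + ε) / (l2norm f + ε)))⁻¹ * l2norm g ^ 2
          ≤ (2 * ((l2norm g + ε) / (l2norm f + ε)))⁻¹ * (l2norm g + ε) ^ 2 := by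
        gcongr; linarith
      have e3 : (l2norm g + ε) / (l2norm f + ε) / 2 * (l2norm f + ε) ^ 2
          + (2 * ((l2norm g + ε) / (l2norm f + ε)))⁻¹ * (l2norm g + ε) ^ 2
          = (l2norm f + ε) * (l2norm g + ε) := by
        field_simp; ring
      linarith
    have ht : Tendsto (fun ε : ℝ => (l2norm f + ε) * (l2norm g + ε)) (𝓝[>] 0)
        (𝓝 (l2norm f * l2norm g)) := by
      have : Continuous fun ε : ℝ => (l2norm f + ε) * (l2norm g + ε) := by fun_prop
      simpa using (this.tendsto 0).mono_left nhdsWithin_le_nhds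
    exact ge_of_tendsto ht (eventually_mem_nhdsWithin.mono h1)
  rw [abs_le]
  refine ⟨?_, key f g⟩
  have h := key (-f) g
  have e : l2norm (-f) = l2norm f := by simp [l2norm]
  rw [neg_mul, map_neg, e] at h
  linarith

theorem exists_form_bound (c : ℝ) (p r : C(ℝ, ℝ)) (a₀ a₁ : ℝ) :
    ∃ C : ℝ, 0 ≤ C ∧ ∀ w : C(ℝ, ℝ), |form c p r a₀ a₁ w w| ≤ C * integ (w * w) := by
  obtain ⟨C, hC, h⟩ := exists_lowerOp_bound p r a₀ a₁
  refine ⟨|c| + C, by positivity, fun w => ?_⟩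
  have hN := l2norm_nonneg w
  rw [form_eq_integ, add_mul, map_add, smul_mul_assoc, map_smul, smul_eq_mul]
  have h1 := abs_integ_mul_le (lowerOp p r a₀ a₁ w) w
  have h2 : l2norm (lowerOp p r a₀ a₁ w) ≤ C * l2norm w :=
    l2norm_le_of_forall (by positivity) fun y hy => (h w y (Ioo_subset_Icc_self hy)).2
  have h3 := mul_le_mul_of_nonneg_right h2 hN
  refine (abs_add_le _ _).trans ?_
  rw [abs_mul, abs_of_nonneg (integ_sq_nonneg w), ← l2norm_sq]
  nlinarith

theorem form_add_smul (c : ℝ) (p r : C(ℝ, ℝ)) (a₀ a₁ t : ℝ) (w v : C(ℝ, ℝ)) :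
    form c p r a₀ a₁ (w + t • v) (w + t • v)
      = form c p r a₀ a₁ w w + 2 * t * form c p r a₀ a₁ w v + t ^ 2 * form c p r a₀ a₁ v v := by
  have e : ∀ q f g : C(ℝ, ℝ), integ (q * (f + t • g) * (f + t • g))
      = integ (q * f * f) + 2 * t * integ (q * f * g) + t ^ 2 * integ (q * g * g) := by
    intro q f g
    have : q * (f + t • g) * (f + t • g) = q * f * f + (2 * t) • (q * f * g)
        + (t ^ 2) • (q * g * g) := by
      ext y; simp; ring
    rw [this]; simp
  have e1 := e 1 w v
  simp only [one_mul] at e1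
  simp only [form, map_add, map_smul, e, e1, ContinuousMap.add_apply, ContinuousMap.smul_apply,
    smul_eq_mul]
  ring

/-- For a nonnegative form, the residual is controlled by the value of the form. -/
theorem exists_residual_bound (c : ℝ) (p r : C(ℝ, ℝ)) (a₀ a₁ : ℝ)
    (hpos : ∀ w, 0 ≤ form c p r a₀ a₁ w w) :
    ∃ C : ℝ, 0 < C ∧ ∀ w : C(ℝ, ℝ),
      integ ((c • w + lowerOp p r a₀ a₁ w) * (c • w + lowerOp p r a₀ a₁ w))
        ≤ C * form c p r a₀ a₁ w w := by
  obtain ⟨C, hC, h⟩ := exists_form_bound c p r a₀ a₁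
  refine ⟨C + 1, by positivity, fun w => ?_⟩
  set v := c • w + lowerOp p r a₀ a₁ w with hv
  -- Test nonnegativity by a step from `w` against the residual `v`, the gradient direction, since
  -- `form w v = ∫ v²`. The step `1/(C+1)` makes the quadratic term at most half the linear gain.
  have h1 := hpos (w + (-(C + 1)⁻¹) • v)
  have h2 : form c p r a₀ a₁ w v = integ (v * v) := form_eq_integ ..
  rw [form_add_smul, h2] at h1
  have h3 := (abs_le.1 (h v)).2
  have h4 := integ_sq_nonneg v
  have h5 : (-(C + 1)⁻¹) ^ 2 * form c p r a₀ a₁ v v ≤ (C + 1)⁻¹ * integ (v * v) := by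
    have : (-(C + 1)⁻¹) ^ 2 * form c p r a₀ a₁ v v
        ≤ (-(C + 1)⁻¹) ^ 2 * ((C + 1) * integ (v * v)) := by
      gcongr; nlinarith
    refine this.trans (le_of_eq ?_)
    field_simp
  have h6 : (C + 1)⁻¹ * integ (v * v) ≤ form c p r a₀ a₁ w w := by linarith
  rwa [inv_mul_le_iff₀ (by positivity)] at h6

/-! ### Compactness and existence of a null function. -/

theorem exists_continuousMap_eqOn {f : ℝ → ℝ} (hf : ContinuousOn f (Icc 0 1)) :
    ∃ F : C(ℝ, ℝ), EqOn F f (Icc 0 1) := by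
  refine ⟨⟨IccExtend zero_le_one (domRestrict (Icc 0 1) f),
    (continuousOn_iff_continuous_domRestrict.1 hf).Icc_extend'⟩, fun y hy => ?_⟩
  exact IccExtend_of_mem zero_le_one (domRestrict (Icc 0 1) f) hy

theorem exists_subseq_tendstoUniformlyOn (f : ℕ → C(ℝ, ℝ)) (M : ℝ) (K : NNReal)
    (hM : ∀ n, ∀ y ∈ Icc (0 : ℝ) 1, |f n y| ≤ M)
    (hK : ∀ n, LipschitzOnWith K (f n) (Icc 0 1)) :
    ∃ m : C(ℝ, ℝ), ∃ φ : ℕ → ℕ, StrictMono φ ∧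
      TendstoUniformlyOn (fun n => f (φ n)) m atTop (Icc 0 1) := by
  let F : ℕ → BoundedContinuousFunction (Icc (0 : ℝ) 1) ℝ := fun n =>
    BoundedContinuousFunction.mkOfCompact ((f n).restrict (Icc 0 1))
  have hF : ∀ n x, F n x = f n x := fun n x => rfl
  have hcomp : IsCompact (closure (range F)) := by
    refine BoundedContinuousFunction.arzela_ascoli (Icc (-M) M) isCompact_Icc _ ?_ ?_
    · rintro _ x ⟨n, rfl⟩
      exact abs_le.1 (hM n x x.2)
    · refine (LipschitzWith.uniformEquicontinuous _ K ?_).equicontinuous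
      rintro ⟨_, n, rfl⟩
      exact (hK n).to_restrict
  obtain ⟨G, -, φ, hφ, hG⟩ := hcomp.tendsto_subseq (fun n => subset_closure (mem_range_self n))
  obtain ⟨m, hm⟩ := exists_continuousMap_eqOn (f := IccExtend zero_le_one G)
    (G.continuous.Icc_extend').continuousOn
  refine ⟨m, φ, hφ, ?_⟩
  rw [tendstoUniformlyOn_iff_tendstoUniformly_comp_coe]
  have := BoundedContinuousFunction.tendsto_iff_tendstoUniformly.1 hG
  convert this using 1
  · ext n x
    exact (hF (φ n) x).symm
  · ext x
    simp [hm x.2]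

/-- Identity plus compact: along a subsequence `lowerOp (w n)` converges uniformly to some `m`. The
vanishing residual then drives `w n` to `-m/c` in `L²`, a continuous limit that inherits the
normalization and solves the limiting equation. -/
theorem exists_null_of_seq {c : ℝ} (hc : 0 < c) (p r : C(ℝ, ℝ)) (a₀ a₁ : ℝ) (w : ℕ → C(ℝ, ℝ))
    (hw : ∀ n, integ (w n * w n) = 1)
    (hres : Tendsto (fun n => integ ((c • w n + lowerOp p r a₀ a₁ (w n)) *
      (c • w n + lowerOp p r a₀ a₁ (w n)))) atTop (𝓝 0)) :
    ∃ v : C(ℝ, ℝ), 0 < integ (v * v) ∧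
      ∀ y ∈ Icc (0 : ℝ) 1, c * v y + lowerOp p r a₀ a₁ v y = 0 := by
  obtain ⟨C, hC, hb⟩ := exists_lowerOp_bound p r a₀ a₁
  have hN : ∀ n, l2norm (w n) = 1 := fun n => by rw [l2norm, hw, Real.sqrt_one]
  obtain ⟨m, φ, hφ, hm⟩ := exists_subseq_tendstoUniformlyOn
    (fun n => lowerOp p r a₀ a₁ (w n)) C C.toNNReal
    (fun n y hy => by simpa [hN] using (hb (w n) y hy).2)
    (fun n => by
      refine (convex_Icc 0 1).lipschitzOnWith_of_nnnorm_hasDerivWithin_le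
        (f' := lowerOpDeriv p r a₀ a₁ (w n))
        (fun y _ => (hasDerivAt_lowerOp p r a₀ a₁ (w n) y).hasDerivWithinAt) fun y hy => ?_
      rw [← NNReal.coe_le_coe, coe_nnnorm, Real.coe_toNNReal _ hC]
      simpa [hN] using (hb (w n) y hy).1)
  set v : C(ℝ, ℝ) := -c⁻¹ • m with hv
  have hconv : Tendsto (fun n => integ ((w (φ n) - v) * (w (φ n) - v))) atTop (𝓝 0) := by
    have hres' := hres.comp hφ.tendsto_atTop
    rw [Metric.tendsto_atTop] at hres' ⊢
    intro ε hε
    obtain ⟨N1, h1⟩ := hres' (c ^ 2 * ε / 4) (by positivity)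
    -- With `ε` the target, `c²(w - v)² ≤ 2A² + 2δ²`, and each of the two terms contributes at most
    -- `c²ε/2`.
    set δ := √(c ^ 2 * ε / 4) with hδ
    have hδ0 : 0 < δ := by positivity
    have hδ2 : δ ^ 2 = c ^ 2 * ε / 4 := Real.sq_sqrt (by positivity)
    obtain ⟨N2, h2⟩ := eventually_atTop.1 (Metric.tendstoUniformlyOn_iff.1 hm δ hδ0)
    refine ⟨max N1 N2, fun n hn => ?_⟩
    have h1 := h1 n (le_of_max_le_left hn)
    have h2 := h2 n (le_of_max_le_right hn)
    rw [Real.dist_eq, sub_zero] at h1 ⊢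
    rw [abs_of_nonneg (integ_sq_nonneg _)]
    set A := c • w (φ n) + lowerOp p r a₀ a₁ (w (φ n)) with hA
    have h1' : integ (A * A) < c ^ 2 * ε / 4 := (le_abs_self _).trans_lt h1
    have h3 : integ ((c ^ 2) • ((w (φ n) - v) * (w (φ n) - v)))
        ≤ integ ((2 : ℝ) • (A * A) + ContinuousMap.const ℝ (2 * δ ^ 2)) := by
      refine integ_mono fun y hy => ?_
      have h4 := h2 y (Ioo_subset_Icc_self hy)
      rw [dist_comm, Real.dist_eq] at h4
      have h5 : (lowerOp p r a₀ a₁ (w (φ n)) y - m y) ^ 2 ≤ δ ^ 2 := sq_le_sq' (by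
        linarith [(abs_lt.1 h4).1]) (abs_lt.1 h4).2.le
      have h6 : c * (w (φ n) y - v y) = A y - (lowerOp p r a₀ a₁ (w (φ n)) y - m y) := by
        simp [hA, hv]; field_simp; ring
      simp only [ContinuousMap.smul_apply, ContinuousMap.mul_apply, ContinuousMap.sub_apply,
        ContinuousMap.add_apply, ContinuousMap.const_apply, smul_eq_mul]
      calc c ^ 2 * ((w (φ n) y - v y) * (w (φ n) y - v y))
          = (c * (w (φ n) y - v y)) ^ 2 := by ring
        _ = (A y - (lowerOp p r a₀ a₁ (w (φ n)) y - m y)) ^ 2 := by rw [h6]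
        _ ≤ _ := by nlinarith [sq_nonneg (A y + (lowerOp p r a₀ a₁ (w (φ n)) y - m y))]
    rw [map_smul, map_add, map_smul, integ_const, smul_eq_mul, smul_eq_mul, hδ2] at h3
    have h7 : c ^ 2 * integ ((w (φ n) - v) * (w (φ n) - v)) < c ^ 2 * ε := by linarith
    exact lt_of_mul_lt_mul_left h7 (by positivity)
  refine ⟨v, ?_, fun y hy => ?_⟩
  · obtain ⟨n, hn⟩ := (hconv.eventually (gt_mem_nhds (show (0 : ℝ) < 1 / 4 by norm_num))).exists
    have : integ (w (φ n) * w (φ n))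
        ≤ integ ((2 : ℝ) • (v * v) + (2 : ℝ) • ((w (φ n) - v) * (w (φ n) - v))) := by
      refine integ_mono fun y _ => ?_
      simp only [ContinuousMap.smul_apply, ContinuousMap.mul_apply, ContinuousMap.sub_apply,
        ContinuousMap.add_apply, smul_eq_mul]
      nlinarith [sq_nonneg (w (φ n) y - 2 * v y)]
    rw [hw, map_add, map_smul, map_smul, smul_eq_mul, smul_eq_mul] at this
    linarith
  · have t1 := hm.tendsto_at hy
    have t2 : Tendsto (fun n => lowerOp p r a₀ a₁ (w (φ n)) y) atTop
        (𝓝 (lowerOp p r a₀ a₁ v y)) := by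
      rw [tendsto_iff_dist_tendsto_zero]
      have t3 : Tendsto (fun n => C * l2norm (w (φ n) - v)) atTop (𝓝 0) := by
        have := (Real.continuous_sqrt.tendsto 0).comp hconv
        simpa [l2norm, Function.comp_def] using this.const_mul C
      refine squeeze_zero (fun _ => dist_nonneg) (fun n => ?_) t3
      have := (hb (w (φ n) - v) y hy).2
      rwa [lowerOp_sub] at this
    rw [tendsto_nhds_unique t2 t1]
    simp [hv]
    field_simp
    ring

/-! ### The critical growth rate. -/

/-- If a family of quadratic forms `s X + s² Y - Z` on `C(ℝ,ℝ)` is negative somewhere for some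
`s > 0` but nowhere for large `s`, then at some critical `s > 0` it is nonnegative, and nearly
vanishes along a sequence of normalized functions. -/
theorem exists_critical (X Y Z : C(ℝ, ℝ) → ℝ) {CX CY : ℝ}
    (hX : ∀ w, |X w| ≤ CX * integ (w * w)) (hY : ∀ w, |Y w| ≤ CY * integ (w * w))
    (hXs : ∀ (a : ℝ) w, X (a • w) = a ^ 2 * X w) (hYs : ∀ (a : ℝ) w, Y (a • w) = a ^ 2 * Y w)
    (hZs : ∀ (a : ℝ) w, Z (a • w) = a ^ 2 * Z w)
    (hneg : ∃ s > 0, ∃ w, s * X w + s ^ 2 * Y w - Z w < 0)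
    (hlarge : ∃ S : ℝ, ∀ s ≥ S, ∀ w, 0 ≤ s * X w + s ^ 2 * Y w - Z w)
    (hdeg : ∀ w, integ (w * w) = 0 → ∀ s, s * X w + s ^ 2 * Y w - Z w = 0) :
    ∃ s > 0, (∀ w, 0 ≤ s * X w + s ^ 2 * Y w - Z w) ∧ ∃ w : ℕ → C(ℝ, ℝ),
      (∀ n, integ (w n * w n) = 1) ∧
      Tendsto (fun n => s * X (w n) + s ^ 2 * Y (w n) - Z (w n)) atTop (𝓝 0) := by
  obtain ⟨s₀, hs₀, hw₀⟩ := hneg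
  obtain ⟨S, hS⟩ := hlarge
  set T : Set ℝ := {s | ∃ w, s * X w + s ^ 2 * Y w - Z w < 0} with hT
  have hbdd : BddAbove T := by
    refine ⟨S, ?_⟩
    rintro s ⟨w, hw⟩
    by_contra! h
    exact absurd (hS s h.le w) (not_le.2 hw)
  have hmem : s₀ ∈ T := hw₀
  set s := sSup T with hs
  have hss : s₀ ≤ s := le_csSup hbdd hmem
  have hpos : ∀ w, 0 ≤ s * X w + s ^ 2 * Y w - Z w := by
    intro w
    have hcont : Continuous fun t : ℝ => t * X w + t ^ 2 * Y w - Z w := by fun_prop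
    refine ge_of_tendsto ((hcont.tendsto s).mono_left nhdsWithin_le_nhds)
      ((eventually_mem_nhdsWithin (s := Ioi s)).mono fun t ht => ?_)
    by_contra! h
    exact absurd (le_csSup hbdd ⟨w, h⟩) (not_le.2 ht)
  refine ⟨s, hs₀.trans_le hss, hpos, ?_⟩
  obtain ⟨t, -, -, htt, htT⟩ := (isLUB_csSup ⟨s₀, hmem⟩ hbdd).exists_seq_monotone_tendsto ⟨s₀, hmem⟩
  have hex : ∀ n, ∃ w, integ (w * w) = 1 ∧ t n * X w + t n ^ 2 * Y w - Z w < 0 := by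
    intro n
    obtain ⟨w, hw⟩ := htT n
    -- A function vanishing only on `[0,1]` has zero seminorm without being zero; `hdeg` rules it
    -- out, so normalization is possible.
    have h0 : integ (w * w) ≠ 0 := fun h => hw.ne (hdeg w h _)
    have h1 : 0 < integ (w * w) := lt_of_le_of_ne (integ_sq_nonneg w) h0.symm
    have hN : 0 < l2norm w := Real.sqrt_pos.2 h1
    refine ⟨(l2norm w)⁻¹ • w, ?_, ?_⟩
    · rw [smul_mul_smul_comm, map_smul, ← l2norm_sq, smul_eq_mul]
      field_simp
    · rw [hXs, hYs, hZs]
      have : (l2norm w)⁻¹ ^ 2 * (t n * X w + t n ^ 2 * Y w - Z w) < 0 :=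
        mul_neg_of_pos_of_neg (by positivity) hw
      linarith
  choose w hw1 hw2 using hex
  refine ⟨w, hw1, ?_⟩
  -- The form is negative at `t n` and nonnegative at `s`, so its value at `s` is at most the
  -- variation between the two rates. `Z` cancels there.
  have hlim : Tendsto (fun n => |s - t n| * CX + |s ^ 2 - t n ^ 2| * CY) atTop (𝓝 0) := by
    have hc : Continuous fun u : ℝ => |s - u| * CX + |s ^ 2 - u ^ 2| * CY := by fun_prop
    simpa [Function.comp_def] using (hc.tendsto s).comp htt
  refine squeeze_zero (fun n => hpos _) (fun n => ?_) hlim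
  have e1 : (s - t n) * X (w n) ≤ |s - t n| * CX := by
    refine (le_abs_self _).trans ?_
    rw [abs_mul]
    have := hX (w n)
    rw [hw1, mul_one] at this
    gcongr
  have e2 : (s ^ 2 - t n ^ 2) * Y (w n) ≤ |s ^ 2 - t n ^ 2| * CY := by
    refine (le_abs_self _).trans ?_
    rw [abs_mul]
    have := hY (w n)
    rw [hw1, mul_one] at this
    gcongr
  have := hw2 n
  linarith

/-! ### The first-order system: regularity and unique continuation. -/

/-- A classical solution on `[0,1]` of the linear system `ψ' = ψ₁`, `ψ₁' = ψ₂`,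
`ψ₂' = a ψ₁ - b S`, `S' = r ψ`. -/
structure IsModeSystem (b : ℝ) (a r ψ ψ₁ ψ₂ S : ℝ → ℝ) : Prop where
  deriv₀ : ∀ y ∈ Icc (0 : ℝ) 1, HasDerivWithinAt ψ (ψ₁ y) (Icc 0 1) y
  deriv₁ : ∀ y ∈ Icc (0 : ℝ) 1, HasDerivWithinAt ψ₁ (ψ₂ y) (Icc 0 1) y
  deriv₂ : ∀ y ∈ Icc (0 : ℝ) 1, HasDerivWithinAt ψ₂ (a y * ψ₁ y - b * S y) (Icc 0 1) y
  deriv₃ : ∀ y ∈ Icc (0 : ℝ) 1, HasDerivWithinAt S (r y * ψ y) (Icc 0 1) y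

theorem hasDerivAt_eq_zero_of_eqOn_zero {f : ℝ → ℝ} {f' y : ℝ} {U : Set ℝ}
    (hf : HasDerivAt f f' y) (hU : IsOpen U) (hy : y ∈ U) (h0 : ∀ z ∈ U, f z = 0) : f' = 0 := by
  have h2 : f =ᶠ[𝓝 y] fun _ => 0 := mem_of_superset (hU.mem_nhds hy) h0
  exact hf.unique ((hasDerivAt_const y (0 : ℝ)).congr_of_eventuallyEq h2)

theorem contDiffOn_succ_of_hasDerivWithinAt {f f' : ℝ → ℝ} {n : ℕ}
    (h : ∀ y ∈ Icc (0 : ℝ) 1, HasDerivWithinAt f (f' y) (Icc 0 1) y)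
    (h' : ContDiffOn ℝ n f' (Icc 0 1)) : ContDiffOn ℝ (n + 1 : ℕ) f (Icc 0 1) := by
  have hu : UniqueDiffOn ℝ (Icc (0 : ℝ) 1) := uniqueDiffOn_Icc zero_lt_one
  push_cast
  rw [contDiffOn_succ_iff_derivWithin hu]
  refine ⟨fun y hy => (h y hy).differentiableWithinAt, by simp, ?_⟩
  exact h'.congr fun y hy => (h y hy).derivWithin (hu y hy)

namespace IsModeSystem

variable {b : ℝ} {a r ψ ψ₁ ψ₂ S : ℝ → ℝ}

/-- Bootstrap: each derivative is a combination of the four unknowns with smooth coefficients, so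
every pass gains one order. -/
theorem contDiffOn (h : IsModeSystem b a r ψ ψ₁ ψ₂ S) (ha : ContDiffOn ℝ ∞ a (Icc 0 1))
    (hr : ContDiffOn ℝ ∞ r (Icc 0 1)) :
    ContDiffOn ℝ ∞ ψ (Icc 0 1) ∧ ContDiffOn ℝ ∞ ψ₁ (Icc 0 1) ∧ ContDiffOn ℝ ∞ ψ₂ (Icc 0 1) ∧
      ContDiffOn ℝ ∞ S (Icc 0 1) := by
  have key : ∀ n : ℕ, ContDiffOn ℝ n ψ (Icc 0 1) ∧ ContDiffOn ℝ n ψ₁ (Icc 0 1) ∧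
      ContDiffOn ℝ n ψ₂ (Icc 0 1) ∧ ContDiffOn ℝ n S (Icc 0 1) := by
    intro n
    induction n with
    | zero =>
      simp only [Nat.cast_zero, contDiffOn_zero]
      exact ⟨fun y hy => (h.deriv₀ y hy).continuousWithinAt,
        fun y hy => (h.deriv₁ y hy).continuousWithinAt,
        fun y hy => (h.deriv₂ y hy).continuousWithinAt,
        fun y hy => (h.deriv₃ y hy).continuousWithinAt⟩
    | succ n ih =>
      obtain ⟨i0, i1, i2, i3⟩ := ih
      have ha' : ContDiffOn ℝ n a (Icc 0 1) := ha.of_le (by exact_mod_cast le_top)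
      have hr' : ContDiffOn ℝ n r (Icc 0 1) := hr.of_le (by exact_mod_cast le_top)
      exact ⟨contDiffOn_succ_of_hasDerivWithinAt h.deriv₀ i1,
        contDiffOn_succ_of_hasDerivWithinAt h.deriv₁ i2,
        contDiffOn_succ_of_hasDerivWithinAt h.deriv₂
          ((ha'.mul i1).sub (contDiffOn_const.mul i3)),
        contDiffOn_succ_of_hasDerivWithinAt h.deriv₃ (hr'.mul i0)⟩
  simp only [contDiffOn_infty]
  exact ⟨fun n => (key n).1, fun n => (key n).2.1, fun n => (key n).2.2.1,
    fun n => (key n).2.2.2⟩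

/-- Uniqueness for the initial value problem at `y₀`, by an energy estimate. -/
theorem eq_zero_of_eq_zero (h : IsModeSystem b a r ψ ψ₁ ψ₂ S) {M : ℝ}
    (ha : ∀ y ∈ Icc (0 : ℝ) 1, |a y| ≤ M) (hr : ∀ y ∈ Icc (0 : ℝ) 1, |r y| ≤ M)
    {y₀ : ℝ} (hy₀ : y₀ ∈ Icc (0 : ℝ) 1) (h0 : ψ y₀ = 0) (h1 : ψ₁ y₀ = 0) (h2 : ψ₂ y₀ = 0)
    (h3 : S y₀ = 0) : ∀ y ∈ Icc (0 : ℝ) 1, ψ y = 0 := by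
  set E : ℝ → ℝ := fun y => ψ y ^ 2 + ψ₁ y ^ 2 + ψ₂ y ^ 2 + S y ^ 2 with hE
  set E' : ℝ → ℝ := fun y => 2 * ψ y * ψ₁ y + 2 * ψ₁ y * ψ₂ y
    + 2 * ψ₂ y * (a y * ψ₁ y - b * S y) + 2 * S y * (r y * ψ y) with hE'
  have hd : ∀ y ∈ Icc (0 : ℝ) 1, HasDerivWithinAt E (E' y) (Icc 0 1) y := by
    intro y hy
    refine (((((h.deriv₀ y hy).pow 2).add ((h.deriv₁ y hy).pow 2)).add
      ((h.deriv₂ y hy).pow 2)).add ((h.deriv₃ y hy).pow 2)).congr_deriv ?_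
    simp [hE']
  set C : ℝ := 2 + 2 * M + |b| with hC
  have hM : 0 ≤ M := (abs_nonneg _).trans (ha 0 (by simp))
  have hb : ∀ y ∈ Icc (0 : ℝ) 1, |E' y| ≤ C * E y := by
    intro y hy
    have two : ∀ u v : ℝ, |2 * u * v| ≤ u ^ 2 + v ^ 2 := fun u v =>
      abs_le.2 ⟨by nlinarith [sq_nonneg (u + v)], by nlinarith [sq_nonneg (u - v)]⟩
    have t1 := two (ψ y) (ψ₁ y)
    have t2 := two (ψ₁ y) (ψ₂ y)
    have t3 : |a y * (2 * ψ₂ y * ψ₁ y)| ≤ M * (ψ₂ y ^ 2 + ψ₁ y ^ 2) := by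
      rw [abs_mul]; exact mul_le_mul (ha y hy) (two _ _) (abs_nonneg _) hM
    have t4 : |b * (2 * ψ₂ y * S y)| ≤ |b| * (ψ₂ y ^ 2 + S y ^ 2) := by
      rw [abs_mul]; exact mul_le_mul_of_nonneg_left (two _ _) (abs_nonneg _)
    have t5 : |r y * (2 * S y * ψ y)| ≤ M * (S y ^ 2 + ψ y ^ 2) := by
      rw [abs_mul]; exact mul_le_mul (hr y hy) (two _ _) (abs_nonneg _) hM
    have e : E' y = 2 * ψ y * ψ₁ y + 2 * ψ₁ y * ψ₂ y + a y * (2 * ψ₂ y * ψ₁ y)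
        - b * (2 * ψ₂ y * S y) + r y * (2 * S y * ψ y) := by simp only [hE']; ring
    have m0 := mul_nonneg hM (sq_nonneg (ψ y))
    have m1 := mul_nonneg hM (sq_nonneg (ψ₁ y))
    have m2 := mul_nonneg hM (sq_nonneg (ψ₂ y))
    have m3 := mul_nonneg hM (sq_nonneg (S y))
    have b0 := mul_nonneg (abs_nonneg b) (sq_nonneg (ψ y))
    have b1 := mul_nonneg (abs_nonneg b) (sq_nonneg (ψ₁ y))
    have s0 := sq_nonneg (ψ y)
    have s2 := sq_nonneg (ψ₂ y)
    have s3 := sq_nonneg (S y)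
    have hCE : C * E y = 2 * (ψ y ^ 2 + ψ₁ y ^ 2 + ψ₂ y ^ 2 + S y ^ 2)
        + 2 * (M * ψ y ^ 2 + M * ψ₁ y ^ 2 + M * ψ₂ y ^ 2 + M * S y ^ 2)
        + (|b| * ψ y ^ 2 + |b| * ψ₁ y ^ 2 + |b| * ψ₂ y ^ 2 + |b| * S y ^ 2) := by
      simp only [hC, hE]; ring
    rw [e, hCE]
    rw [abs_le] at t1 t2 t3 t4 t5 ⊢
    constructor <;> nlinarith
  have hEexp : ∀ k : ℝ, ∀ y ∈ Icc (0 : ℝ) 1, HasDerivWithinAt (fun y => E y * Real.exp (k * y))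
      ((E' y + k * E y) * Real.exp (k * y)) (Icc 0 1) y := by
    intro k y hy
    have he : HasDerivWithinAt (fun y => Real.exp (k * y)) (Real.exp (k * y) * (k * 1)) (Icc 0 1) y :=
      (((hasDerivAt_id y).const_mul k).exp).hasDerivWithinAt
    refine ((hd y hy).mul he).congr_deriv ?_
    ring
  have hint : ∀ k : ℝ, ∀ y ∈ interior (Icc (0 : ℝ) 1),
      deriv (fun y => E y * Real.exp (k * y)) y = (E' y + k * E y) * Real.exp (k * y) := by
    intro k y hy
    exact ((hEexp k y (interior_subset hy)).hasDerivAt (mem_interior_iff_mem_nhds.1 hy)).deriv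
  have hdiff : ∀ k : ℝ, DifferentiableOn ℝ (fun y => E y * Real.exp (k * y))
      (interior (Icc (0 : ℝ) 1)) := fun k y hy =>
    ((hEexp k y (interior_subset hy)).mono interior_subset).differentiableWithinAt
  have hcont : ∀ k : ℝ, ContinuousOn (fun y => E y * Real.exp (k * y)) (Icc (0 : ℝ) 1) :=
    fun k y hy => (hEexp k y hy).continuousWithinAt
  -- From `|E'| ≤ C E`, Grönwall in both directions: this weight handles points left of `y₀`, the
  -- opposite one points to the right.
  have hmono : MonotoneOn (fun y => E y * Real.exp (C * y)) (Icc 0 1) := by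
    refine monotoneOn_of_deriv_nonneg (convex_Icc 0 1) (hcont C) (hdiff C) fun y hy => ?_
    rw [hint C y hy]
    have := (abs_le.1 (hb y (interior_subset hy))).1
    exact mul_nonneg (by linarith) (Real.exp_pos _).le
  have hanti : AntitoneOn (fun y => E y * Real.exp (-C * y)) (Icc 0 1) := by
    refine antitoneOn_of_deriv_nonpos (convex_Icc 0 1) (hcont (-C)) (hdiff (-C)) fun y hy => ?_
    rw [hint (-C) y hy]
    have := (abs_le.1 (hb y (interior_subset hy))).2
    exact mul_nonpos_of_nonpos_of_nonneg (by linarith) (Real.exp_pos _).le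
  have hE0 : E y₀ = 0 := by simp [hE, h0, h1, h2, h3]
  intro y hy
  have hEy : E y ≤ 0 := by
    rcases le_total y y₀ with hle | hle
    · have := hmono hy hy₀ hle
      simp only [hE0, zero_mul] at this
      exact nonpos_of_mul_nonpos_left this (Real.exp_pos _)
    · have := hanti hy₀ hy hle
      simp only [hE0, zero_mul] at this
      exact nonpos_of_mul_nonpos_left this (Real.exp_pos _)
  have : ψ y ^ 2 ≤ 0 := by
    have e : E y = ψ y ^ 2 + ψ₁ y ^ 2 + ψ₂ y ^ 2 + S y ^ 2 := rfl
    nlinarith [sq_nonneg (ψ₁ y), sq_nonneg (ψ₂ y), sq_nonneg (S y)]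
  exact pow_eq_zero_iff two_ne_zero |>.1 (le_antisymm this (sq_nonneg _))

/-- A solution that vanishes on a nonempty open interval vanishes identically. -/
theorem eq_zero_of_eqOn_zero (h : IsModeSystem b a r ψ ψ₁ ψ₂ S) (hb : b ≠ 0) {M : ℝ}
    (ha : ∀ y ∈ Icc (0 : ℝ) 1, |a y| ≤ M) (hr : ∀ y ∈ Icc (0 : ℝ) 1, |r y| ≤ M)
    {U : Set ℝ} (hU : IsOpen U) (hne : U.Nonempty) (hUI : U ⊆ Icc 0 1)
    (hψ : ∀ y ∈ U, ψ y = 0) : ∀ y ∈ Icc (0 : ℝ) 1, ψ y = 0 := by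
  have step : ∀ f f' : ℝ → ℝ, (∀ y ∈ Icc (0 : ℝ) 1, HasDerivWithinAt f (f' y) (Icc 0 1) y) →
      (∀ y ∈ U, f y = 0) → ∀ y ∈ U, f' y = 0 := by
    intro f f' hf h0 y hy
    exact hasDerivAt_eq_zero_of_eqOn_zero
      ((hf y (hUI hy)).hasDerivAt (mem_of_superset (hU.mem_nhds hy) hUI)) hU hy h0
  have z1 := step _ _ h.deriv₀ hψ
  have z2 := step _ _ h.deriv₁ z1
  have z3 := step _ _ h.deriv₂ z2
  obtain ⟨y₀, hy₀⟩ := hne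
  refine h.eq_zero_of_eq_zero ha hr (hUI hy₀) (hψ y₀ hy₀) (z1 y₀ hy₀) (z2 y₀ hy₀) ?_
  -- Where `ψ₁` and `ψ₂'` vanish, the third equation reduces to `b S = 0`.
  have := z3 y₀ hy₀
  rw [z1 y₀ hy₀, mul_zero, zero_sub, neg_eq_zero] at this
  exact (mul_eq_zero.1 this).resolve_left hb

end IsModeSystem

/-! ### Sobolev norms of separable fields. -/

theorem dX_iterate_const_mul (c : ℝ) (f : ℝ → ℝ → ℝ) (i : ℕ) :
    dX^[i] (fun x y => c * f x y) = fun x y => c * dX^[i] f x y := by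
  induction i generalizing f with
  | zero => rfl
  | succ i ih =>
    rw [Function.iterate_succ_apply, Function.iterate_succ_apply, ← ih]
    congr 1
    ext x y
    simp [dX]

theorem dY_iterate_const_mul (c : ℝ) (f : ℝ → ℝ → ℝ) (j : ℕ) :
    dY^[j] (fun x y => c * f x y) = fun x y => c * dY^[j] f x y := by
  induction j generalizing f with
  | zero => rfl
  | succ j ih =>
    rw [Function.iterate_succ_apply, Function.iterate_succ_apply, ← ih]
    congr 1
    ext x y
    exact derivWithin_const_mul_field c

theorem dX_dY_iterate_separable (X Y : ℝ → ℝ) (i j : ℕ) :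
    dX^[i] (dY^[j] fun x y => X x * Y y)
      = fun x y => iteratedDeriv i X x * iteratedDerivWithin j Y (Icc 0 1) y := by
  have hY : dY^[j] (fun x y => X x * Y y)
      = fun x y => X x * iteratedDerivWithin j Y (Icc 0 1) y := by
    induction j with
    | zero => simp
    | succ j ih =>
      rw [Function.iterate_succ_apply', ih]
      ext x y
      rw [iteratedDerivWithin_succ]
      exact derivWithin_const_mul_field (X x)
  rw [hY]
  induction i with
  | zero => simp
  | succ i ih =>
    rw [Function.iterate_succ_apply', ih]
    ext x y
    simp [dX, iteratedDeriv_succ]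

theorem sobolevNorm_const_mul (L : ℝ) (k : ℕ) {n : ℕ} (c : ℝ) (f : Fin n → ℝ → ℝ → ℝ) :
    sobolevNorm L k (fun a x y => c * f a x y) = ‖c‖ₑ * sobolevNorm L k f := by
  have h2 : (‖c‖ₑ ^ 2) ^ (1 / 2 : ℝ) = ‖c‖ₑ := by
    rw [← ENNReal.rpow_natCast, ← ENNReal.rpow_mul]
    norm_num
  simp only [sobolevNorm]
  rw [← h2, ← ENNReal.mul_rpow_of_nonneg _ _ (by norm_num : (0 : ℝ) ≤ 1 / 2)]
  congr 1
  simp only [Finset.mul_sum]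
  refine Finset.sum_congr rfl fun a _ => Finset.sum_congr rfl fun i _ =>
    Finset.sum_congr rfl fun j _ => ?_
  rw [← lintegral_const_mul' _ _ (by simp)]
  refine lintegral_congr fun p => ?_
  rw [dY_iterate_const_mul, dX_iterate_const_mul, enorm_mul, mul_pow]

theorem sobolevNorm_lt_top (L : ℝ) (k : ℕ) {n : ℕ} {f : Fin n → ℝ → ℝ → ℝ}
    (X Y : Fin n → ℝ → ℝ) (hf : ∀ a, f a = fun x y => X a x * Y a y)
    (hX : ∀ a, ContDiff ℝ ∞ (X a)) (hY : ∀ a, ContDiffOn ℝ ∞ (Y a) (Icc 0 1)) :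
    sobolevNorm L k f < ⊤ := by
  refine ENNReal.rpow_lt_top_of_nonneg (by norm_num) (ne_of_lt ?_)
  refine ENNReal.sum_lt_top.2 fun a _ => ENNReal.sum_lt_top.2 fun i _ =>
    ENNReal.sum_lt_top.2 fun j _ => ?_
  rw [hf a, dX_dY_iterate_separable]
  have cX : Continuous (iteratedDeriv i (X a)) :=
    (hX a).continuous_iteratedDeriv i (by exact_mod_cast le_top)
  have cY : ContinuousOn (iteratedDerivWithin j (Y a) (Icc 0 1)) (Icc 0 1) :=
    (hY a).continuousOn_iteratedDerivWithin (by exact_mod_cast le_top)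
      (uniqueDiffOn_Icc zero_lt_one)
  obtain ⟨A, hA⟩ := (isCompact_Icc (a := (0 : ℝ)) (b := 2 * Real.pi * L)).exists_bound_of_continuousOn
    cX.continuousOn
  obtain ⟨B, hB⟩ := isCompact_Icc.exists_bound_of_continuousOn cY
  have hbound : ∀ p ∈ Ioo (0 : ℝ) (2 * Real.pi * L) ×ˢ Ioo (0 : ℝ) 1,
      ‖iteratedDeriv i (X a) p.1 * iteratedDerivWithin j (Y a) (Icc 0 1) p.2‖ₑ ^ 2
        ≤ ENNReal.ofReal (A * B) ^ 2 := by
    rintro ⟨x, y⟩ ⟨hx, hy⟩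
    gcongr
    rw [← ofReal_norm, norm_mul]
    have h1 := hA x (Ioo_subset_Icc_self hx)
    exact ENNReal.ofReal_le_ofReal (mul_le_mul h1 (hB y (Ioo_subset_Icc_self hy))
      (norm_nonneg _) ((norm_nonneg _).trans h1))
  refine (setLIntegral_mono' (measurableSet_Ioo.prod measurableSet_Ioo) hbound).trans_lt ?_
  rw [setLIntegral_const, Measure.volume_eq_prod, Measure.prod_prod]
  simp only [Real.volume_Ioo]
  exact ENNReal.mul_lt_top (by simp) (ENNReal.mul_lt_top (by simp) (by simp))

theorem sobolevNorm_zero_le (L : ℝ) (k : ℕ) {n : ℕ} (f : Fin n → ℝ → ℝ → ℝ) (a : Fin n) :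
    sobolevNorm L 0 ![f a] ≤ sobolevNorm L k f := by
  unfold sobolevNorm
  refine ENNReal.rpow_le_rpow ?_ (by norm_num)
  simp only [Finset.univ_unique, Finset.sum_singleton, zero_add, Finset.range_one, Nat.sub_zero]
  refine le_trans ?_ (Finset.single_le_sum (fun _ _ => zero_le) (Finset.mem_univ a))
  refine le_trans ?_ (Finset.single_le_sum (fun _ _ => zero_le)
    (Finset.mem_range.2 (Nat.succ_pos k)))
  exact Finset.single_le_sum (f := fun j => ∫⁻ p in Ioo (0 : ℝ) (2 * Real.pi * L) ×ˢ Ioo (0 : ℝ) 1,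
      ‖(dX^[0] (dY^[j] (f a))) p.1 p.2‖ₑ ^ 2) (fun _ _ => zero_le)
    (Finset.mem_range.2 (Nat.succ_pos k))

/-- A continuous function that is zero almost everywhere on an open set is zero there, so one
nonzero value suffices. -/
theorem sobolevNorm_zero_pos {L : ℝ} {f : ℝ → ℝ → ℝ} {X Y : ℝ → ℝ}
    (hf : f = fun x y => X x * Y y) (hX : Continuous X) (hY : ContinuousOn Y (Icc 0 1))
    (hx : ∃ x ∈ Ioo (0 : ℝ) (2 * Real.pi * L), X x ≠ 0) (hy : ∃ y ∈ Ioo (0 : ℝ) 1, Y y ≠ 0) :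
    0 < sobolevNorm L 0 ![f] := by
  unfold sobolevNorm
  refine ENNReal.rpow_pos_of_nonneg ?_ (by norm_num)
  simp only [Finset.univ_unique, Finset.sum_singleton, zero_add, Finset.range_one, Nat.sub_zero,
    Function.iterate_zero, id_eq, Fin.default_eq_zero, Matrix.cons_val_zero]
  set U := Ioo (0 : ℝ) (2 * Real.pi * L) ×ˢ Ioo (0 : ℝ) 1
  have hU : IsOpen U := isOpen_Ioo.prod isOpen_Ioo
  have hc : ContinuousOn (fun p : ℝ × ℝ => f p.1 p.2) U := by
    rw [hf]
    exact (hX.comp continuous_fst).continuousOn.mul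
      (hY.comp continuousOn_snd fun p hp => Ioo_subset_Icc_self hp.2)
  rw [pos_iff_ne_zero]
  intro h0
  rw [lintegral_eq_zero_iff'
    ((hc.aestronglyMeasurable hU.measurableSet).enorm.pow_const 2)] at h0
  have h1 : (fun p : ℝ × ℝ => f p.1 p.2) =ᵐ[volume.restrict U] fun _ => 0 := by
    filter_upwards [h0] with p hp
    simpa using hp
  have h2 := Measure.eqOn_open_of_ae_eq h1 hU hc continuousOn_const
  obtain ⟨x, hx, hXx⟩ := hx
  obtain ⟨y, hy, hYy⟩ := hy
  have h3 : f x y = 0 := h2 (show (x, y) ∈ U from ⟨hx, hy⟩)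
  rw [hf] at h3
  exact mul_ne_zero hXx hYy h3

/-! ### Trace inequalities and test functions for the form. -/

theorem form_smul (c : ℝ) (p r : C(ℝ, ℝ)) (a₀ a₁ t : ℝ) (w : C(ℝ, ℝ)) :
    form c p r a₀ a₁ (t • w) (t • w) = t ^ 2 * form c p r a₀ a₁ w w := by
  simp only [form, map_smul, mul_smul_comm, smul_mul_assoc, ContinuousMap.smul_apply, smul_eq_mul]
  ring

theorem form_combine (c₁ c₂ c₃ : ℝ) (p₁ p₂ p₃ r₁ r₂ r₃ : C(ℝ, ℝ)) (a₁ a₂ a₃ b₁ b₂ b₃ s t : ℝ)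
    (w : C(ℝ, ℝ)) :
    s * form c₁ p₁ r₁ a₁ b₁ w w + t * form c₂ p₂ r₂ a₂ b₂ w w - form c₃ p₃ r₃ a₃ b₃ w w
      = form (s * c₁ + t * c₂ - c₃) (s • p₁ + t • p₂ - p₃) (s • r₁ + t • r₂ - r₃)
        (s * a₁ + t * a₂ - a₃) (s * b₁ + t * b₂ - b₃) w w := by
  simp only [form, add_mul, sub_mul, smul_mul_assoc, map_add, map_sub, map_smul, smul_eq_mul]
  ring

theorem integ_smul (a : ℝ) (f : C(ℝ, ℝ)) : integ (a • f) = a * integ f := map_smul integ a f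

/-- Integrate the derivative of `y ψ'(y)²`, whose weight kills the other endpoint, and split the
cross term by Young. The small factor on `∫ w²` lets viscosity absorb a boundary term of any sign.
-/
theorem trace_one (w : C(ℝ, ℝ)) {ε : ℝ} (hε : 0 < ε) :
    psi1 w 1 * psi1 w 1 ≤ (1 + ε⁻¹) * integ (psi1 w * psi1 w) + ε * integ (w * w) := by
  have h := integ_eq_sub (F := ContinuousMap.id ℝ * (psi1 w * psi1 w))
    (f := psi1 w * psi1 w + (2 : ℝ) • (ContinuousMap.id ℝ * (psi1 w * w))) fun y => by
      refine ((hasDerivAt_id y).mul ((hasDerivAt_psi1 w y).mul (hasDerivAt_psi1 w y))).congr_deriv ?_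
      simp
      ring
  have h2 : integ (psi1 w * psi1 w + (2 : ℝ) • (ContinuousMap.id ℝ * (psi1 w * w)))
      ≤ integ ((1 + ε⁻¹) • (psi1 w * psi1 w) + ε • (w * w)) := by
    refine integ_mono fun y hy => ?_
    simp only [ContinuousMap.smul_apply, ContinuousMap.mul_apply,
        ContinuousMap.add_apply, ContinuousMap.id_apply, smul_eq_mul]
    have e : ε⁻¹ * (psi1 w y * psi1 w y) + ε * (w y * w y) - 2 * (y * (psi1 w y * w y))
        = ε⁻¹ * (y * psi1 w y - ε * w y) ^ 2 + ε⁻¹ * ((1 - y) * (1 + y)) * psi1 w y ^ 2 := by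
      field_simp; ring
    have p1 : 0 ≤ ε⁻¹ * (y * psi1 w y - ε * w y) ^ 2 := by positivity
    have p2 : 0 ≤ ε⁻¹ * ((1 - y) * (1 + y)) * psi1 w y ^ 2 := by
      have : 0 ≤ 1 - y := by linarith [hy.2]
      have : 0 ≤ 1 + y := by linarith [hy.1]
      positivity
    linarith
  rw [h, map_add, map_smul, map_smul] at h2
  simpa using h2

theorem trace_zero (w : C(ℝ, ℝ)) {ε : ℝ} (hε : 0 < ε) :
    psi1 w 0 * psi1 w 0 ≤ (1 + ε⁻¹) * integ (psi1 w * psi1 w) + ε * integ (w * w) := by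
  have h := integ_eq_sub (F := (ContinuousMap.id ℝ - ContinuousMap.const ℝ 1) * (psi1 w * psi1 w))
    (f := psi1 w * psi1 w
      + (2 : ℝ) • ((ContinuousMap.id ℝ - ContinuousMap.const ℝ 1) * (psi1 w * w))) fun y => by
      refine (((hasDerivAt_id y).sub_const 1).mul
        ((hasDerivAt_psi1 w y).mul (hasDerivAt_psi1 w y))).congr_deriv ?_
      simp
      ring
  have h2 : integ (psi1 w * psi1 w
      + (2 : ℝ) • ((ContinuousMap.id ℝ - ContinuousMap.const ℝ 1) * (psi1 w * w)))
      ≤ integ ((1 + ε⁻¹) • (psi1 w * psi1 w) + ε • (w * w)) := by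
    refine integ_mono fun y hy => ?_
    simp only [ContinuousMap.smul_apply, ContinuousMap.mul_apply, ContinuousMap.sub_apply,
        ContinuousMap.add_apply, ContinuousMap.id_apply, ContinuousMap.const_apply, smul_eq_mul]
    have e : ε⁻¹ * (psi1 w y * psi1 w y) + ε * (w y * w y) - 2 * ((y - 1) * (psi1 w y * w y))
        = ε⁻¹ * ((y - 1) * psi1 w y - ε * w y) ^ 2 + ε⁻¹ * (y * (2 - y)) * psi1 w y ^ 2 := by
      field_simp; ring
    have p1 : 0 ≤ ε⁻¹ * ((y - 1) * psi1 w y - ε * w y) ^ 2 := by positivity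
    have p2 : 0 ≤ ε⁻¹ * (y * (2 - y)) * psi1 w y ^ 2 := by
      have : 0 ≤ 2 - y := by linarith [hy.2]
      have : 0 ≤ y := hy.1.le
      positivity
    linarith
  rw [h, map_add, map_smul, map_smul] at h2
  simpa using h2

/-- Two functions with the same second derivative differ by an affine function, which the two
boundary values kill. -/
theorem psi_eq_of_hasDerivAt {f f' : ℝ → ℝ} {w : C(ℝ, ℝ)} (hf : ∀ y, HasDerivAt f (f' y) y)
    (hf' : ∀ y, HasDerivAt f' (w y) y) (h0 : f 0 = 0) (h1 : f 1 = 0) (y : ℝ) : psi w y = f y := by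
  have e1 : ∀ y, psi1 w y - f' y = psi1 w 0 - f' 0 := fun y =>
    is_const_of_deriv_eq_zero (f := fun y => psi1 w y - f' y)
      (fun y => ((hasDerivAt_psi1 w y).sub (hf' y)).differentiableAt)
      (fun y => (((hasDerivAt_psi1 w y).sub (hf' y)).congr_deriv (sub_self _)).deriv) y 0
  set κ := psi1 w 0 - f' 0
  have hd : ∀ y, HasDerivAt (fun y => psi w y - f y - y * κ) (psi1 w y - f' y - 1 * κ) y :=
    fun y => ((hasDerivAt_psi w y).sub (hf y)).sub ((hasDerivAt_id y).mul_const κ)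
  have e2 : ∀ y, psi w y - f y - y * κ = 0 := fun y => by
    have := is_const_of_deriv_eq_zero (f := fun y => psi w y - f y - y * κ)
      (fun y => (hd y).differentiableAt) (fun y => by rw [(hd y).deriv, e1 y]; ring) y 0
    simpa [h0] using this
  have e3 : κ = 0 := by simpa [h1] using e2 1
  have := e2 y
  rw [e3] at this
  linarith

theorem integ_pos {f : C(ℝ, ℝ)} (h : ∀ y ∈ Icc (0 : ℝ) 1, 0 ≤ f y)
    (h' : ∃ y ∈ Icc (0 : ℝ) 1, 0 < f y) : 0 < integ f :=
  intervalIntegral.integral_pos zero_lt_one f.continuous.continuousOn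
    (fun y hy => h y (Ioc_subset_Icc_self hy)) h'

/-- A weight that is positive somewhere gives positive mass to some admissible `ψ`. -/
theorem exists_integ_weight_pos (d : C(ℝ, ℝ)) (hd : ∃ y ∈ Ioo (0 : ℝ) 1, 0 < d y) :
    ∃ w : C(ℝ, ℝ), 0 < integ (d * psi w * psi w) := by
  obtain ⟨y₀, hy₀, hdy⟩ := hd
  have hopen : IsOpen (Ioo (0 : ℝ) 1 ∩ {y | 0 < d y}) :=
    isOpen_Ioo.inter (isOpen_lt continuous_const d.continuous)
  obtain ⟨δ, hδ, hball⟩ := Metric.isOpen_iff.1 hopen y₀ ⟨hy₀, hdy⟩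
  -- A bump supported where `d > 0`, inside `(0,1)`; its second derivative is the required `w`.
  let φ : ContDiffBump y₀ := ⟨δ / 2, δ, by linarith, by linarith⟩
  have hφ : ContDiff ℝ ∞ (φ : ℝ → ℝ) := φ.contDiff
  have hφ1 : ContDiff ℝ ∞ (deriv φ) := hφ.iterate_deriv 1
  have hφ2 : ContDiff ℝ ∞ (deriv (deriv φ)) := hφ.iterate_deriv 2
  have hz : ∀ y, y ∉ Metric.ball y₀ δ → φ y = 0 := fun y hy => by
    rw [← φ.support_eq, Function.notMem_support] at hy
    exact hy
  let w : C(ℝ, ℝ) := ⟨deriv (deriv φ), hφ2.continuous⟩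
  have hw : ∀ y, psi w y = φ y := psi_eq_of_hasDerivAt
    (fun y => (hφ.differentiable (by simp) y).hasDerivAt)
    (fun y => (hφ1.differentiable (by simp) y).hasDerivAt)
    (hz 0 fun h => absurd (hball h).1 (by simp)) (hz 1 fun h => absurd (hball h).1 (by simp))
  refine ⟨w, integ_pos (fun y _ => ?_) ⟨y₀, Ioo_subset_Icc_self hy₀, ?_⟩⟩
  · simp only [ContinuousMap.mul_apply, hw]
    by_cases hy : y ∈ Metric.ball y₀ δ
    · rw [mul_assoc]
      exact mul_nonneg (hball hy).2.le (mul_self_nonneg _)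
    · rw [hz y hy, mul_zero]
  · simp only [ContinuousMap.mul_apply, hw]
    have : φ y₀ = 1 := φ.one_of_mem_closedBall (by simp [φ.rIn_pos.le])
    rw [this]
    simpa using hdy

/-! ### Existence of an unstable mode. -/

/-- The boundary value problem of the normal modes of horizontal wave number `ξ` has a nontrivial
solution with positive growth rate `s`. -/
theorem exists_unstable_mode {μ g ξ : ℝ} (hμ : 0 < μ) (hg : 0 < g) (hξ : 0 < ξ) (k₀ k₁ : ℝ)
    (ρ d : C(ℝ, ℝ)) (hρ : ∃ c > 0, ∀ y ∈ Ioo (0 : ℝ) 1, c ≤ ρ y)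
    (hd : ∃ y ∈ Ioo (0 : ℝ) 1, 0 < d y) :
    ∃ s > 0, ∃ ψ ψ₁ ψ₂ S : ℝ → ℝ,
      IsModeSystem (s * μ)⁻¹ (fun y => (s * μ)⁻¹ * (2 * s * μ * ξ ^ 2 + s ^ 2 * ρ y))
        (fun y => s * μ * ξ ^ 4 + s ^ 2 * ξ ^ 2 * ρ y - g * ξ ^ 2 * d y) ψ ψ₁ ψ₂ S ∧
      ψ 0 = 0 ∧ ψ 1 = 0 ∧ ψ₂ 0 = -(k₀ / μ) * ψ₁ 0 ∧ ψ₂ 1 = k₁ / μ * ψ₁ 1 ∧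
      ∃ y ∈ Icc (0 : ℝ) 1, ψ y ≠ 0 := by
  set X : C(ℝ, ℝ) → ℝ := fun w => form μ (ContinuousMap.const ℝ (2 * μ * ξ ^ 2))
    (ContinuousMap.const ℝ (μ * ξ ^ 4)) k₀ k₁ w w with hX
  set Y : C(ℝ, ℝ) → ℝ := fun w => form 0 ρ (ξ ^ 2 • ρ) 0 0 w w with hY
  set Z : C(ℝ, ℝ) → ℝ := fun w => form 0 0 ((g * ξ ^ 2) • d) 0 0 w w with hZ
  obtain ⟨CX, -, hCX⟩ := exists_form_bound μ (ContinuousMap.const ℝ (2 * μ * ξ ^ 2))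
    (ContinuousMap.const ℝ (μ * ξ ^ 4)) k₀ k₁
  obtain ⟨CY, -, hCY⟩ := exists_form_bound 0 ρ (ξ ^ 2 • ρ) 0 0
  obtain ⟨CZ, -, hCZ⟩ := exists_form_bound 0 0 ((g * ξ ^ 2) • d) 0 0
  have hneg : ∃ s > 0, ∃ w, s * X w + s ^ 2 * Y w - Z w < 0 := by
    obtain ⟨w, hw⟩ := exists_integ_weight_pos d hd
    have hZw : 0 < Z w := by
      have : Z w = g * ξ ^ 2 * integ (d * psi w * psi w) := by
        simp [hZ, form]
      rw [this]; positivity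
    have hc : Continuous fun s : ℝ => s * X w + s ^ 2 * Y w - Z w := by fun_prop
    have ht : Tendsto (fun s : ℝ => s * X w + s ^ 2 * Y w - Z w) (𝓝[>] 0) (𝓝 (-Z w)) := by
      simpa using (hc.tendsto 0).mono_left nhdsWithin_le_nhds
    obtain ⟨s, hs, hs'⟩ := ((ht.eventually (gt_mem_nhds (show -Z w < 0 by linarith))).and
      eventually_mem_nhdsWithin).exists
    exact ⟨s, hs', w, hs⟩
  have hlarge : ∃ S₀ : ℝ, ∀ s ≥ S₀, ∀ w, 0 ≤ s * X w + s ^ 2 * Y w - Z w := by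
    obtain ⟨c₀, hc₀, hρ⟩ := hρ
    obtain ⟨M, hM0, hM⟩ := exists_bound_Icc d
    set κ := |k₀| + |k₁| with hκ
    have hκ0 : 0 ≤ κ := by positivity
    -- Chosen so that `κ ε ≤ μ`: the viscous term absorbs the `∫ w²` part of the traces.
    set ε := μ / (κ + 1) with hε
    have hε0 : 0 < ε := by positivity
    set K := 1 + ε⁻¹ with hK
    have hK0 : 0 < K := by positivity
    -- The second summand lets `s² ∫ ρ ψ'²` absorb the rest of the traces, the third lets `s² ξ² ∫ ρ
    -- ψ²` absorb gravity; `1 ≤ s` gives `s ≤ s²`.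
    refine ⟨1 + κ * K / c₀ + g * M / c₀, fun s hs w => ?_⟩
    have hq1 : 0 ≤ κ * K / c₀ := by positivity
    have hq2 : 0 ≤ g * M / c₀ := by positivity
    have hs1 : 1 ≤ s := by linarith
    have hs0 : 0 < s := by linarith
    have hs2 : κ * K ≤ s * c₀ := by
      rw [← div_le_iff₀ hc₀]; linarith
    have hs3 : g * M ≤ s * c₀ := by
      rw [← div_le_iff₀ hc₀]; linarith
    have hs4 : g * M ≤ s ^ 2 * c₀ := hs3.trans (by gcongr; nlinarith)
    set W := integ (w * w) with hW
    set P := integ (psi1 w * psi1 w) with hP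
    set N := integ (psi w * psi w) with hN
    have hW0 : 0 ≤ W := integ_sq_nonneg w
    have hP0 : 0 ≤ P := integ_sq_nonneg _
    have hN0 : 0 ≤ N := integ_sq_nonneg _
    have weight_le : ∀ u : C(ℝ, ℝ), c₀ * integ (u * u) ≤ integ (ρ * u * u) := fun u => by
      rw [← integ_smul]
      refine integ_mono fun y hy => ?_
      simp only [ContinuousMap.smul_apply, ContinuousMap.mul_apply, smul_eq_mul, mul_assoc]
      exact mul_le_mul_of_nonneg_right (hρ y hy) (mul_self_nonneg _)
    have h1 := weight_le (psi1 w)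
    have h2 := weight_le (psi w)
    have h3 : integ (d * psi w * psi w) ≤ M * N := by
      rw [hN, ← integ_smul]
      refine integ_mono fun y hy => ?_
      simp only [ContinuousMap.smul_apply, ContinuousMap.mul_apply, smul_eq_mul, mul_assoc]
      exact mul_le_mul_of_nonneg_right
        ((le_abs_self _).trans (hM y (Ioo_subset_Icc_self hy))) (mul_self_nonneg _)
    have h4 : k₁ * (psi1 w 1 * psi1 w 1) ≤ |k₁| * (K * P + ε * W) :=
      mul_le_mul (le_abs_self _) (trace_one w hε0) (mul_self_nonneg _) (abs_nonneg _)
    have h5 : k₀ * (psi1 w 0 * psi1 w 0) ≤ |k₀| * (K * P + ε * W) :=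
      mul_le_mul (le_abs_self _) (trace_zero w hε0) (mul_self_nonneg _) (abs_nonneg _)
    have hconst : ∀ (a : ℝ) (u : C(ℝ, ℝ)), integ (ContinuousMap.const ℝ a * u * u)
        = a * integ (u * u) := fun a u => by
      rw [← integ_smul]
      congr 1
      ext y
      simp [mul_assoc]
    have eX : X w = μ * W + 2 * μ * ξ ^ 2 * P + μ * ξ ^ 4 * N - k₁ * (psi1 w 1 * psi1 w 1)
        - k₀ * (psi1 w 0 * psi1 w 0) := by
      simp only [hX, form, hconst]
      ring
    have eY : Y w = integ (ρ * psi1 w * psi1 w) + ξ ^ 2 * integ (ρ * psi w * psi w) := by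
      simp [hY, form]
    have eZ : Z w = g * ξ ^ 2 * integ (d * psi w * psi w) := by
      simp [hZ, form]
    have h6 : κ * (ε * W) ≤ μ * W := by
      rw [← mul_assoc]
      refine mul_le_mul_of_nonneg_right ?_ hW0
      rw [hε, mul_div_assoc', div_le_iff₀ (by positivity)]
      nlinarith
    have h7 : s * (κ * K) * P ≤ s * (s * c₀) * P := by gcongr
    have h8 : ξ ^ 2 * (g * M) * N ≤ ξ ^ 2 * (s ^ 2 * c₀) * N := by gcongr
    have f1 : s * (k₁ * (psi1 w 1 * psi1 w 1) + k₀ * (psi1 w 0 * psi1 w 0))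
        ≤ s * (κ * K * P + μ * W) := by
      refine mul_le_mul_of_nonneg_left ?_ hs0.le
      have : |k₁| * (K * P + ε * W) + |k₀| * (K * P + ε * W) = κ * K * P + κ * (ε * W) := by
        rw [hκ]; ring
      linarith
    have f2 : s ^ 2 * (c₀ * P) ≤ s ^ 2 * integ (ρ * psi1 w * psi1 w) := by gcongr
    have f3 : s ^ 2 * ξ ^ 2 * (c₀ * N) ≤ s ^ 2 * ξ ^ 2 * integ (ρ * psi w * psi w) := by gcongr
    have f4 : g * ξ ^ 2 * integ (d * psi w * psi w) ≤ g * ξ ^ 2 * (M * N) := by gcongr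
    have f5 : 0 ≤ s * (2 * μ * ξ ^ 2 * P) := by positivity
    have f6 : 0 ≤ s * (μ * ξ ^ 4 * N) := by positivity
    rw [eX, eY, eZ]
    linarith
  obtain ⟨s, hs, hpos, w, hw1, hw⟩ := exists_critical X Y Z hCX hCY
    (fun a w => form_smul ..) (fun a w => form_smul ..) (fun a w => form_smul ..) hneg hlarge
    (fun w hw s => by
      have h1 := hCX w
      have h2 := hCY w
      have h3 := hCZ w
      rw [hw, mul_zero] at h1 h2 h3
      rw [show X w = 0 from abs_nonpos_iff.1 h1, show Y w = 0 from abs_nonpos_iff.1 h2,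
        show Z w = 0 from abs_nonpos_iff.1 h3]
      ring)
  have hc : 0 < s * μ := by positivity
  set p : C(ℝ, ℝ) := s • ContinuousMap.const ℝ (2 * μ * ξ ^ 2) + s ^ 2 • ρ - 0 with hp
  set r : C(ℝ, ℝ) := s • ContinuousMap.const ℝ (μ * ξ ^ 4) + s ^ 2 • ξ ^ 2 • ρ
    - (g * ξ ^ 2) • d with hr
  have hform : ∀ w, s * X w + s ^ 2 * Y w - Z w = form (s * μ) p r (s * k₀) (s * k₁) w w := by
    intro w
    simp only [hX, hY, hZ, form_combine]
    simp [hp, hr]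
  simp only [hform] at hpos hw
  obtain ⟨C, hC, hres⟩ := exists_residual_bound (s * μ) p r (s * k₀) (s * k₁) hpos
  obtain ⟨v, hv0, hv⟩ := exists_null_of_seq hc p r (s * k₀) (s * k₁) w hw1
    (squeeze_zero (fun n => integ_sq_nonneg _) (fun n => hres (w n)) (by simpa using hw.const_mul C))
  set m := lowerOp p r (s * k₀) (s * k₁) v with hm
  -- `ψ₂` is `-lowerOp v/(sμ)`, which equals `v` on `[0,1]` and is visibly differentiable. `S` is
  -- the non-local part of its derivative, so `ρ` itself is never differentiated.
  refine ⟨s, hs, psi v, psi1 v, fun y => -((s * μ)⁻¹ * m y),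
    fun y => lowerSlope p r (s * k₀) (s * k₁) v + prim (r * psi v) y,
    ⟨fun y _ => (hasDerivAt_psi v y).hasDerivWithinAt, fun y hy => ?_, fun y _ => ?_, fun y _ => ?_⟩,
    psi_zero v, psi_one v, ?_, ?_, ?_⟩
  · refine (hasDerivAt_psi1 v y).hasDerivWithinAt.congr_deriv ?_
    have := hv y hy
    field_simp
    linarith
  · refine ((hasDerivAt_lowerOp p r (s * k₀) (s * k₁) v y).const_mul
      (s * μ)⁻¹).neg.hasDerivWithinAt.congr_deriv ?_
    have e1 : lowerOpDeriv p r (s * k₀) (s * k₁) v y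
        = lowerSlope p r (s * k₀) (s * k₁) v - p y * psi1 v y + prim (r * psi v) y := rfl
    have e2 : p y = 2 * s * μ * ξ ^ 2 + s ^ 2 * ρ y := by simp [hp]; ring
    rw [e1, e2]
    ring
  · refine ((hasDerivAt_prim (r * psi v) y).const_add _).hasDerivWithinAt.congr_deriv ?_
    have e : r y = s * μ * ξ ^ 4 + s ^ 2 * ξ ^ 2 * ρ y - g * ξ ^ 2 * d y := by simp [hr]; ring
    exact congrArg (· * psi v y) e
  · simp only [hm, lowerOp_zero]
    field_simp
  · simp only [hm, lowerOp_one]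
    field_simp
  · by_contra! h
    have z0 : ∀ y ∈ Ioo (0 : ℝ) 1, psi v y = 0 := fun y hy => h y (Ioo_subset_Icc_self hy)
    have z1 : ∀ y ∈ Ioo (0 : ℝ) 1, psi1 v y = 0 := fun y hy =>
      hasDerivAt_eq_zero_of_eqOn_zero (hasDerivAt_psi v y) isOpen_Ioo hy z0
    have z2 : ∀ y ∈ Ioo (0 : ℝ) 1, v y = 0 := fun y hy =>
      hasDerivAt_eq_zero_of_eqOn_zero (hasDerivAt_psi1 v y) isOpen_Ioo hy z1
    have : integ (v * v) = integ 0 := integ_congr fun y hy => by simp [z2 y hy]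
    rw [map_zero] at this
    exact hv0.ne' this

/-! ### Derivatives and norms of separable modes. -/

/-- The separable field `exp (s t) X(x) Y(y)`. -/
noncomputable def modeField (s : ℝ) (X Y : ℝ → ℝ) (t x y : ℝ) : ℝ :=
  Real.exp (s * t) * (X x * Y y)

theorem isSmoothPeriodic_modeField {L s : ℝ} {X Y : ℝ → ℝ} (hX : ContDiff ℝ ∞ X)
    (hXp : ∀ x, X (x + 2 * Real.pi * L) = X x) (hY : ContDiffOn ℝ ∞ Y (Icc 0 1)) :
    IsSmoothPeriodic L (modeField s X Y) := by
  refine ⟨?_, fun t _ x y _ => by simp only [modeField, hXp]⟩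
  unfold modeField
  refine ContDiffOn.mul ?_ (ContDiffOn.mul ?_ ?_)
  · exact (Real.contDiff_exp.comp (contDiff_const.mul contDiff_fst)).contDiffOn
  · exact (hX.comp (contDiff_fst.comp contDiff_snd)).contDiffOn
  · exact hY.comp (contDiff_snd.comp contDiff_snd).contDiffOn fun p hp => hp.2.2

theorem dT_modeField (s : ℝ) (X Y : ℝ → ℝ) {t : ℝ} (ht : t ∈ Ici (0 : ℝ)) (x y : ℝ) :
    dT (modeField s X Y) t x y = s * modeField s X Y t x y := by
  have h : HasDerivAt (fun t => modeField s X Y t x y) (s * modeField s X Y t x y) t := by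
    refine ((((hasDerivAt_id t).const_mul s).exp).mul_const (X x * Y y)).congr_deriv ?_
    simp only [modeField, id_eq]
    ring
  exact h.hasDerivWithinAt.derivWithin (uniqueDiffOn_Ici 0 t ht)

theorem dX_modeField (s : ℝ) {X X' : ℝ → ℝ} (hX : ∀ x, HasDerivAt X (X' x) x) (Y : ℝ → ℝ) (t : ℝ) :
    dX (modeField s X Y t) = modeField s X' Y t := by
  ext x y
  exact (((hX x).mul_const (Y y)).const_mul (Real.exp (s * t))).deriv

theorem dY_modeField (s : ℝ) (X : ℝ → ℝ) {Y Y' : ℝ → ℝ}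
    (hY : ∀ y ∈ Icc (0 : ℝ) 1, HasDerivWithinAt Y (Y' y) (Icc 0 1) y) (t x : ℝ) {y : ℝ}
    (hy : y ∈ Icc (0 : ℝ) 1) : dY (modeField s X Y t) x y = modeField s X Y' t x y :=
  (((hY y hy).const_mul (X x)).const_mul (Real.exp (s * t))).derivWithin
    (uniqueDiffOn_Icc zero_lt_one y hy)

theorem lap_modeField (s : ℝ) {X X' X'' Y Y' Y'' : ℝ → ℝ} (hX : ∀ x, HasDerivAt X (X' x) x)
    (hX' : ∀ x, HasDerivAt X' (X'' x) x)
    (hY : ∀ y ∈ Icc (0 : ℝ) 1, HasDerivWithinAt Y (Y' y) (Icc 0 1) y)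
    (hY' : ∀ y ∈ Icc (0 : ℝ) 1, HasDerivWithinAt Y' (Y'' y) (Icc 0 1) y) (t x : ℝ) {y : ℝ}
    (hy : y ∈ Icc (0 : ℝ) 1) :
    lap (modeField s X Y t) x y = modeField s X'' Y t x y + modeField s X Y'' t x y := by
  have h : dY (dY (modeField s X Y t)) x y = dY (modeField s X Y' t) x y :=
    derivWithin_congr (fun z hz => dY_modeField s X hY t x hz) (dY_modeField s X hY t x hy)
  rw [lap, dX_modeField s hX, dX_modeField s hX', h, dY_modeField s X hY' t x hy]

theorem sobolevNorm_modeField (L : ℝ) (k : ℕ) (s : ℝ) (X Y : ℝ → ℝ) (t : ℝ) :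
    sobolevNorm L k ![modeField s X Y t]
      = ENNReal.ofReal (Real.exp (s * t)) * sobolevNorm L k ![modeField s X Y 0] := by
  rw [← Real.enorm_of_nonneg (Real.exp_pos _).le, ← sobolevNorm_const_mul]
  congr 1
  ext a x y
  fin_cases a
  simp [modeField]

/-- Mean value theorem on `[0, y]`; it makes the horizontal velocity nontrivial. -/
theorem IsModeSystem.exists_deriv_ne_zero {b : ℝ} {a r ψ ψ₁ ψ₂ S : ℝ → ℝ}
    (h : IsModeSystem b a r ψ ψ₁ ψ₂ S) (h0 : ψ 0 = 0) {y : ℝ} (hy : y ∈ Ioo (0 : ℝ) 1)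
    (hψ : ψ y ≠ 0) : ∃ z ∈ Ioo (0 : ℝ) 1, ψ₁ z ≠ 0 := by
  have hsub : Icc 0 y ⊆ Icc (0 : ℝ) 1 := Icc_subset_Icc_right hy.2.le
  obtain ⟨z, hz, hz'⟩ := exists_hasDerivAt_eq_slope ψ ψ₁ hy.1
    (fun x hx => (h.deriv₀ x (hsub hx)).continuousWithinAt.mono hsub)
    (fun x hx => (h.deriv₀ x (hsub (Ioo_subset_Icc_self hx))).hasDerivAt
      (Icc_mem_nhds hx.1 (hx.2.trans hy.2)))
  refine ⟨z, ⟨hz.1, hz.2.trans hy.2⟩, ?_⟩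
  rw [hz', h0, sub_zero, sub_zero]
  exact div_ne_zero hψ hy.1.ne'

theorem exists_smooth_mode {μ g ξ : ℝ} (hμ : 0 < μ) (hg : 0 < g) (hξ : 0 < ξ) (k₀ k₁ : ℝ)
    {ρbar : ℝ → ℝ} (hρ_smooth : ContDiffOn ℝ ∞ ρbar (Icc 0 1))
    (hρ_pos : ∃ c : ℝ, 0 < c ∧ ∀ y ∈ Ioo (0 : ℝ) 1, c ≤ ρbar y)
    (hρ_incr : ∃ y₀ ∈ Ioo (0 : ℝ) 1, 0 < deriv ρbar y₀) :
    ∃ s > 0, ∃ ψ ψ₁ ψ₂ S : ℝ → ℝ,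
      IsModeSystem (s * μ)⁻¹ (fun y => (s * μ)⁻¹ * (2 * s * μ * ξ ^ 2 + s ^ 2 * ρbar y))
        (fun y => s * μ * ξ ^ 4 + s ^ 2 * ξ ^ 2 * ρbar y
          - g * ξ ^ 2 * derivWithin ρbar (Icc 0 1) y) ψ ψ₁ ψ₂ S ∧
      ψ 0 = 0 ∧ ψ 1 = 0 ∧ ψ₂ 0 = -(k₀ / μ) * ψ₁ 0 ∧ ψ₂ 1 = k₁ / μ * ψ₁ 1 ∧
      (ContDiffOn ℝ ∞ ψ (Icc 0 1) ∧ ContDiffOn ℝ ∞ ψ₁ (Icc 0 1) ∧ ContDiffOn ℝ ∞ ψ₂ (Icc 0 1) ∧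
        ContDiffOn ℝ ∞ S (Icc 0 1)) ∧
      ∃ y ∈ Ioo (0 : ℝ) 1, ψ y ≠ 0 ∧ 0 < derivWithin ρbar (Icc 0 1) y := by
  have hρ' : ContDiffOn ℝ ∞ (derivWithin ρbar (Icc 0 1)) (Icc 0 1) :=
    hρ_smooth.derivWithin (uniqueDiffOn_Icc zero_lt_one) le_rfl
  obtain ⟨ρ, hρ⟩ := exists_continuousMap_eqOn hρ_smooth.continuousOn
  obtain ⟨d, hd⟩ := exists_continuousMap_eqOn hρ'.continuousOn
  have hd_pos : ∃ y ∈ Ioo (0 : ℝ) 1, 0 < d y := by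
    obtain ⟨y, hy, h⟩ := hρ_incr
    refine ⟨y, hy, ?_⟩
    rwa [hd (Ioo_subset_Icc_self hy), derivWithin_of_mem_nhds (Icc_mem_nhds hy.1 hy.2)]
  obtain ⟨s, hs, ψ, ψ₁, ψ₂, S, hsys, h0, h1, hb0, hb1, y₁, hy₁, hψ⟩ :=
    exists_unstable_mode hμ hg hξ k₀ k₁ ρ d
      (by
        obtain ⟨c, hc, h⟩ := hρ_pos
        exact ⟨c, hc, fun y hy => by rw [hρ (Ioo_subset_Icc_self hy)]; exact h y hy⟩) hd_pos
  have hsys' : IsModeSystem (s * μ)⁻¹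
      (fun y => (s * μ)⁻¹ * (2 * s * μ * ξ ^ 2 + s ^ 2 * ρbar y))
      (fun y => s * μ * ξ ^ 4 + s ^ 2 * ξ ^ 2 * ρbar y
        - g * ξ ^ 2 * derivWithin ρbar (Icc 0 1) y) ψ ψ₁ ψ₂ S :=
    ⟨hsys.deriv₀, hsys.deriv₁,
      fun y hy => by simpa only [hρ hy] using hsys.deriv₂ y hy,
      fun y hy => by simpa only [hρ hy, hd hy] using hsys.deriv₃ y hy⟩
  refine ⟨s, hs, ψ, ψ₁, ψ₂, S, hsys', h0, h1, hb0, hb1, hsys'.contDiffOn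
    (contDiffOn_const.mul (contDiffOn_const.add (contDiffOn_const.mul hρ_smooth)))
    ((contDiffOn_const.add (contDiffOn_const.mul hρ_smooth)).sub (contDiffOn_const.mul hρ')), ?_⟩
  obtain ⟨A, hA⟩ := isCompact_Icc.exists_bound_of_continuousOn (s := Icc (0 : ℝ) 1)
    (f := fun y => (s * μ)⁻¹ * (2 * s * μ * ξ ^ 2 + s ^ 2 * ρ y)) (by fun_prop)
  obtain ⟨R, hR⟩ := isCompact_Icc.exists_bound_of_continuousOn (s := Icc (0 : ℝ) 1)
    (f := fun y => s * μ * ξ ^ 4 + s ^ 2 * ξ ^ 2 * ρ y - g * ξ ^ 2 * d y) (by fun_prop)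
  -- Otherwise `ψ` vanishes on the nonempty open set where `ρ' > 0`, hence identically by unique
  -- continuation.
  by_contra! hzero
  refine hψ (hsys.eq_zero_of_eqOn_zero (M := max A R) (U := Ioo (0 : ℝ) 1 ∩ {y | 0 < d y})
    (by positivity) (fun y hy => (hA y hy).trans (le_max_left _ _))
    (fun y hy => (hR y hy).trans (le_max_right _ _))
    (isOpen_Ioo.inter (isOpen_lt continuous_const d.continuous)) hd_pos
    (fun y hy => Ioo_subset_Icc_self hy.1) (fun y hy => ?_) y₁ hy₁)
  by_contra hne
  have := hzero y hy.1 hne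
  rw [← hd (Ioo_subset_Icc_self hy.1)] at this
  exact absurd hy.2 (not_lt.2 this)

theorem hasDerivAt_cos_const_mul (ξ x : ℝ) :
    HasDerivAt (fun x => Real.cos (ξ * x)) (-ξ * Real.sin (ξ * x)) x := by
  refine (((hasDerivAt_id x).const_mul ξ).cos).congr_deriv ?_
  simp only [id_eq]
  ring

theorem hasDerivAt_sin_const_mul (ξ x : ℝ) :
    HasDerivAt (fun x => Real.sin (ξ * x)) (ξ * Real.cos (ξ * x)) x := by
  refine (((hasDerivAt_id x).const_mul ξ).sin).congr_deriv ?_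
  simp only [id_eq]
  ring

end NavierSlip

/-! ### Assembly of the growing solution. -/

open NavierSlip in
theorem theorem1p1 (μ g L k₀ k₁ : ℝ) (hμ : 0 < μ) (hg : 0 < g) (hL : 0 < L)
    (ρbar : ℝ → ℝ) (hρ_smooth : ContDiffOn ℝ ∞ ρbar (Icc 0 1))
    (hρ_pos : ∃ c : ℝ, 0 < c ∧ ∀ y ∈ Ioo (0 : ℝ) 1, c ≤ ρbar y)
    (hρ_incr : ∃ y₀ ∈ Ioo (0 : ℝ) 1, 0 < deriv ρbar y₀) :
    ∃ Λ : ℝ, 0 < Λ ∧ ∃ ϱ u₁ u₂ q : ℝ → ℝ → ℝ → ℝ,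
      NavierSlip.IsLinearizedSolution μ g k₀ k₁ L ρbar ϱ u₁ u₂ q ∧
      -- the perturbation is nontrivial in the density and in both velocity components
      0 < NavierSlip.sobolevNorm L 0 ![ϱ 0] ∧
      0 < NavierSlip.sobolevNorm L 0 ![u₁ 0] ∧
      0 < NavierSlip.sobolevNorm L 0 ![u₂ 0] ∧
      ∀ k : ℕ,
        -- all norms are finite
        (∀ t : ℝ, 0 ≤ t → NavierSlip.sobolevNorm L k ![ϱ t, u₁ t, u₂ t, q t] < ⊤) ∧
        -- every component grows exactly like `exp (Λ t)`
        (∀ f ∈ ({ϱ, u₁, u₂, q} : Set (ℝ → ℝ → ℝ → ℝ)), ∀ t : ℝ, 0 ≤ t →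
          NavierSlip.sobolevNorm L k ![f t] =
            ENNReal.ofReal (Real.exp (Λ * t)) * NavierSlip.sobolevNorm L k ![f 0]) ∧
        -- the full norm blows up as `t → ∞`
        Tendsto (fun t : ℝ => NavierSlip.sobolevNorm L k ![ϱ t, u₁ t, u₂ t, q t])
          atTop (𝓝 ⊤) := by
  obtain ⟨ξ, hξ, hξL⟩ : ∃ ξ : ℝ, 0 < ξ ∧ ξ * L = 1 := ⟨L⁻¹, by positivity, by field_simp⟩
  obtain ⟨s, hs, ψ, ψ₁, ψ₂, S, hsys, h0, h1, hb0, hb1, ⟨hψ, hψ₁, hψ₂, hS⟩, y₁, hy₁, hψy, hdy⟩ :=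
    exists_smooth_mode hμ hg hξ k₀ k₁ hρ_smooth hρ_pos hρ_incr
  set ρ' := derivWithin ρbar (Icc 0 1) with hρ'_def
  have hρ' : ContDiffOn ℝ ∞ ρ' (Icc 0 1) :=
    hρ_smooth.derivWithin (uniqueDiffOn_Icc zero_lt_one) le_rfl
  set c : ℝ → ℝ := fun x => Real.cos (ξ * x) with hc
  set σ : ℝ → ℝ := fun x => Real.sin (ξ * x) with hσ
  have hcS : ContDiff ℝ ∞ c := Real.contDiff_cos.comp (contDiff_const.mul contDiff_id)
  have hσS : ContDiff ℝ ∞ σ := Real.contDiff_sin.comp (contDiff_const.mul contDiff_id)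
  have harg : ∀ x, ξ * (x + 2 * Real.pi * L) = ξ * x + 2 * Real.pi := fun x => by
    linear_combination 2 * Real.pi * hξL
  have hcp : ∀ x, c (x + 2 * Real.pi * L) = c x := fun x => by
    simp only [hc, harg, Real.cos_add_two_pi]
  have hσp : ∀ x, σ (x + 2 * Real.pi * L) = σ x := fun x => by
    simp only [hσ, harg, Real.sin_add_two_pi]
  have hc' : ∀ x, HasDerivAt c (-ξ * σ x) x := hasDerivAt_cos_const_mul ξ
  have hσ' : ∀ x, HasDerivAt σ (ξ * c x) x := hasDerivAt_sin_const_mul ξ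
  have hc'' : ∀ x, HasDerivAt (fun x => -ξ * σ x) (-ξ * (ξ * c x)) x :=
    fun x => (hσ' x).const_mul _
  have hσ'' : ∀ x, HasDerivAt (fun x => ξ * c x) (ξ * (-ξ * σ x)) x :=
    fun x => (hc' x).const_mul _
  -- With `ψ` as the profile of `u₂`, transport gives the density, incompressibility gives `u₁`, and
  -- horizontal momentum gives the pressure. Vertical momentum is then the equation for `S'`.
  set Yϱ : ℝ → ℝ := fun y => -s⁻¹ * (ρ' y * ψ y) with hYϱ
  set Yu : ℝ → ℝ := fun y => -ξ⁻¹ * ψ₁ y with hYu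
  set Yq : ℝ → ℝ := fun y => (s * ξ ^ 2)⁻¹ * (s * μ * ξ ^ 2 * ψ₁ y - S y) with hYq
  have sϱ : ContDiffOn ℝ ∞ Yϱ (Icc 0 1) := contDiffOn_const.mul (hρ'.mul hψ)
  have su : ContDiffOn ℝ ∞ Yu (Icc 0 1) := contDiffOn_const.mul hψ₁
  have sq : ContDiffOn ℝ ∞ Yq (Icc 0 1) :=
    contDiffOn_const.mul ((contDiffOn_const.mul hψ₁).sub hS)
  have du : ∀ y ∈ Icc (0 : ℝ) 1, HasDerivWithinAt Yu (-ξ⁻¹ * ψ₂ y) (Icc 0 1) y :=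
    fun y hy => (hsys.deriv₁ y hy).const_mul _
  have ddu := fun y hy => (hsys.deriv₂ y hy).const_mul (-ξ⁻¹)
  have dq : ∀ y ∈ Icc (0 : ℝ) 1, HasDerivWithinAt Yq _ (Icc 0 1) y := fun y hy =>
    (((hsys.deriv₁ y hy).const_mul (s * μ * ξ ^ 2)).sub (hsys.deriv₃ y hy)).const_mul
      (s * ξ ^ 2)⁻¹
  have hcx : ∃ x ∈ Ioo (0 : ℝ) (2 * Real.pi * L), c x ≠ 0 := by
    have := Real.pi_pos
    refine ⟨Real.pi * L, ⟨by positivity, by nlinarith [mul_pos this hL]⟩, ?_⟩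
    have e : ξ * (Real.pi * L) = Real.pi := by linear_combination Real.pi * hξL
    simp [hc, e]
  have hσx : ∃ x ∈ Ioo (0 : ℝ) (2 * Real.pi * L), σ x ≠ 0 := by
    have := Real.pi_pos
    refine ⟨Real.pi / 2 * L, ⟨by positivity, by nlinarith [mul_pos this hL]⟩, ?_⟩
    have e : ξ * (Real.pi / 2 * L) = Real.pi / 2 := by linear_combination Real.pi / 2 * hξL
    simp [hσ, e]
  have sep : ∀ X Y : ℝ → ℝ, modeField s X Y 0 = fun x y => X x * Y y := fun X Y => by
    ext x y; simp [modeField]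
  have hϱ0 : 0 < sobolevNorm L 0 ![modeField s c Yϱ 0] :=
    sobolevNorm_zero_pos (sep _ _) hcS.continuous sϱ.continuousOn hcx
      ⟨y₁, hy₁, mul_ne_zero (neg_ne_zero.2 (inv_ne_zero hs.ne')) (mul_ne_zero hdy.ne' hψy)⟩
  refine ⟨s, hs, modeField s c Yϱ, modeField s σ Yu, modeField s c ψ, modeField s c Yq,
    ?_, hϱ0, ?_, ?_, fun k => ⟨fun t _ => ?_, ?_, ?_⟩⟩
  · exact {
      smooth_density := isSmoothPeriodic_modeField hcS hcp sϱ
      smooth_velocity₁ := isSmoothPeriodic_modeField hσS hσp su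
      smooth_velocity₂ := isSmoothPeriodic_modeField hcS hcp hψ
      smooth_pressure := isSmoothPeriodic_modeField hcS hcp sq
      transport := fun t ht x y hy => by
        rw [dT_modeField s c Yϱ ht, ← derivWithin_of_mem_nhds (Icc_mem_nhds hy.1 hy.2)]
        simp only [modeField, hYϱ]
        field_simp
        ring
      momentum₁ := fun t ht x y hy => by
        have hy' := Ioo_subset_Icc_self hy
        rw [dT_modeField s σ Yu ht, dX_modeField s hc', lap_modeField s hσ' hσ'' du ddu t x hy']
        simp only [modeField, hYu, hYq]
        field_simp
        ring
      momentum₂ := fun t ht x y hy => by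
        have hy' := Ioo_subset_Icc_self hy
        rw [dT_modeField s c ψ ht, dY_modeField s c dq t x hy',
          lap_modeField s hc' hc'' hsys.deriv₀ hsys.deriv₁ t x hy']
        simp only [modeField, hYϱ]
        field_simp
        ring
      incompressible := fun t ht x y hy => by
        rw [dX_modeField s hσ', dY_modeField s c hsys.deriv₀ t x (Ioo_subset_Icc_self hy)]
        simp only [modeField, hYu]
        field_simp
        ring
      no_penetration_lower := fun t _ x => by simp [modeField, h0]
      no_penetration_upper := fun t _ x => by simp [modeField, h1]
      slip_lower := fun t _ x => by
        rw [dY_modeField s σ du t x (by simp)]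
        simp only [modeField, hYu, hb0]
        ring
      slip_upper := fun t _ x => by
        rw [dY_modeField s σ du t x (by simp)]
        simp only [modeField, hYu, hb1]
        ring }
  · obtain ⟨z, hz, hz'⟩ := hsys.exists_deriv_ne_zero h0 hy₁ hψy
    exact sobolevNorm_zero_pos (sep _ _) hσS.continuous su.continuousOn hσx
      ⟨z, hz, mul_ne_zero (neg_ne_zero.2 (inv_ne_zero hξ.ne')) hz'⟩
  · exact sobolevNorm_zero_pos (sep _ _) hcS.continuous hψ.continuousOn hcx ⟨y₁, hy₁, hψy⟩
  · refine sobolevNorm_lt_top L k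
      (fun a x => Real.exp (s * t) * (![c, σ, c, c] a) x) ![Yϱ, Yu, ψ, Yq] ?_ ?_ ?_
    · intro a
      ext x y
      fin_cases a <;> simp [modeField, mul_assoc]
    · intro a
      refine contDiff_const.mul ?_
      fin_cases a
      exacts [hcS, hσS, hcS, hcS]
    · intro a
      fin_cases a
      exacts [sϱ, su, hψ, sq]
  · rintro f (rfl | rfl | rfl | rfl) t - <;> exact sobolevNorm_modeField ..
  -- The density's `L²` norm is a lower bound for the full norm; it is positive at time zero and
  -- grows like `exp (s t)`.
  · have hexp : Tendsto (fun t : ℝ => ENNReal.ofReal (Real.exp (s * t))) atTop (𝓝 ⊤) :=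
      ENNReal.tendsto_ofReal_nhds_top.2
        (Real.tendsto_exp_atTop.comp (tendsto_id.const_mul_atTop hs))
    have hmul := ENNReal.Tendsto.mul_const
      (b := sobolevNorm L 0 ![modeField s c Yϱ 0]) hexp (Or.inl ENNReal.top_ne_zero)
    rw [ENNReal.top_mul hϱ0.ne'] at hmul
    refine tendsto_nhds_top_mono' hmul fun t => ?_
    rw [← sobolevNorm_modeField]
    exact sobolevNorm_zero_le L k
      ![modeField s c Yϱ t, modeField s σ Yu t, modeField s c ψ t, modeField s c Yq t] 0
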